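/- Let $\mathbb D_-=\{|z|>1\}\cup\{\infty\}$ and let $\Sigma'$ be the class of univalent maps $\phi:\mathbb D_-\to\mathbb D_-$ with $\phi(\infty)=\infty$ and $\phi'(\infty)\in\mathbb R$, i.e. $\phi(z)=b z+\cdots$ at $\infty$ with $b$ real. For an angle $\theta$ put $\phi_\theta(z)=e^{i\theta}\phi(e^{-i\theta}z)$, and let $(K_n\phi)(z)=\phi(z^n)^{1/n}$ be the Koebe $n$-root transform, where the root is the holomorphic branch on $\mathbb D_-$ with $(K_n\phi)(z)/z\to b^{1/n}$ (principal root) at $\infty$. Let $\phi\in\Sigma'$, let $k\ge 2$ be an integer, and let $\theta_0,\theta_1,\dots$ be independent random angles uniformly distributed on $\mathbb T=\mathbb R/2\pi\mathbb Z$. Put $f_0=\phi_{\theta_0}$, $f_n=f_{n-1}\circ K_{k^n}\phi_{\theta_n}$. The random conformal snowflake is $f=\lim_n f_n$ on $\mathbb D_-$; let $g=f^{-1}:f(\mathbb D_-)\to\mathbb D_-$. For $t\in\mathbb R$ let $$\bar\beta(t)=\sup\Big\{\beta\in\mathbb R:\ \int_1^R (r-1)^{\beta-1}\int_0^{2\pi}\mathbb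 E\big[|f'(re^{is})|^t\big]\,ds\,dr=\infty\ \text{ for every } R>1\Big\}$$ be the average integral means spectrum of $f$, and for $\beta\in\mathbb R$ and $r>1$ let $$F_\beta(r)=\mathbb E\left[\mathbf 1_{\{r\in f(\mathbb D_-)\}}\ \left|\frac{g'(r)}{g(r)}\right|^{2-t}\log^{\beta-1}|g(r)|\right]\in[0,\infty].$$ Then $$\bar\beta(t)=\inf\big\{\beta\in\mathbb R:\ F_\beta\in L^1(1,R)\ \text{ for every } 1<R<\infty\big\},$$ where the supremum and the infimum are taken in $[-\infty,\infty]$. -/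

import Mathlib

open MeasureTheory ProbabilityTheory Filter Topology Real
open scoped ENNReal

noncomputable section

namespace Snowflake

instance factTwoPiPos : Fact (0 < 2 * π) := ⟨Real.two_pi_pos⟩

/-- The circle `𝕋 = ℝ / 2πℤ` of angles. -/
abbrev Torus : Type := AddCircle (2 * π)

/-- The unimodular number `e^{iθ}`. -/
def expI (θ : Torus) : ℂ := (AddCircle.toCircle θ : ℂ)

/-- The (finite part of the) exterior `𝔻₋` of the closed unit disc. -/
def extDisc : Set ℂ := {z | 1 < ‖z‖}

/-- The class `Σ'`: univalent maps `φ : 𝔻₋ → 𝔻₋` with `φ(∞) = ∞` and real derivative `b` at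
infinity, `φ(z) = b z + ⋯`. (The values of `φ` off `𝔻₋` are irrelevant.) -/
structure IsSigma' (φ : ℂ → ℂ) : Prop where
  holo : DifferentiableOn ℂ φ extDisc
  inj : Set.InjOn φ extDisc
  mapsTo : Set.MapsTo φ extDisc extDisc
  infty : Tendsto φ (Bornology.cobounded ℂ) (Bornology.cobounded ℂ)
  deriv_infty : ∃ b : ℝ, Tendsto (fun z => φ z / z) (Bornology.cobounded ℂ) (𝓝 (b : ℂ))

/-- The rotation `φ_θ(z) = e^{iθ} φ(e^{-iθ} z)`. -/
def rot (φ : ℂ → ℂ) (θ : Torus) (z : ℂ) : ℂ := expI θ * φ (expI (-θ) * z)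

/-- `Φ` is the Koebe `n`-root transform `z ↦ φ(z^n)^{1/n}`, the root being the holomorphic branch
whose derivative at infinity is the principal `n`-th root of that of `φ`. -/
structure IsKoebe (n : ℕ) (φ Φ : ℂ → ℂ) : Prop where
  holo : DifferentiableOn ℂ Φ extDisc
  pow_eq : ∀ z ∈ extDisc, Φ z ^ n = φ (z ^ n)
  branch : ∃ b : ℂ, Tendsto (fun z => φ z / z) (Bornology.cobounded ℂ) (𝓝 b) ∧
    Tendsto (fun z => Φ z / z) (Bornology.cobounded ℂ) (𝓝 (b ^ ((1 : ℂ) / (n : ℂ))))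

/-- The Koebe transform `K_n φ`; for `φ ∈ Σ'` and `n ≥ 1` its values on `𝔻₋` are uniquely
determined by `IsKoebe`. -/
def koebe (n : ℕ) (φ : ℂ → ℂ) : ℂ → ℂ := Classical.epsilon (IsKoebe n φ)

/-- The approximations `f₀ = φ_{θ₀}`, `f_n = f_{n-1} ∘ K_{k^n} φ_{θ_n}`. -/
def approx (φ : ℂ → ℂ) (k : ℕ) (θ : ℕ → Torus) : ℕ → ℂ → ℂ
  | 0 => rot φ (θ 0)
  | n + 1 => approx φ k θ n ∘ koebe (k ^ (n + 1)) (rot φ (θ (n + 1)))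

/-- The conformal snowflake `f = lim f_n` on `𝔻₋` with building block `φ`, integer `k` and
rotations `θ`. -/
def snowflake (φ : ℂ → ℂ) (k : ℕ) (θ : ℕ → Torus) (z : ℂ) : ℂ :=
  limUnder atTop (fun n => approx φ k θ n z)

/-- The inverse `g = f⁻¹ : f(𝔻₋) → 𝔻₋`. -/
def inverse (f : ℂ → ℂ) : ℂ → ℂ := Function.invFunOn f extDisc

variable {Ω : Type*} [MeasurableSpace Ω]

/-- `∫_1^R (r-1)^{β-1} ∫_0^{2π} 𝔼[|f'(r e^{is})|^t] ds dr` for a random function `f` on `𝔻₋`. -/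
def meansIntegral (P : Measure Ω) (f : Ω → ℂ → ℂ) (t β R : ℝ) : ℝ≥0∞ :=
  ∫⁻ r in Set.Ioo 1 R, ENNReal.ofReal ((r - 1) ^ (β - 1)) *
    ∫⁻ s in Set.Ioc 0 (2 * π), ∫⁻ ω,
      ENNReal.ofReal (‖deriv (f ω) (r * Complex.exp (s * Complex.I))‖ ^ t) ∂P

/-- The average integral means spectrum: the supremum (in `[-∞, ∞]`) of the real `β` for which the
integral above diverges at `1`. -/
def avgSpectrum (P : Measure Ω) (f : Ω → ℂ → ℂ) (t : ℝ) : EReal :=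
  sSup ((fun β : ℝ => (β : EReal)) '' {β | ∀ R, 1 < R → meansIntegral P f t β R = ∞})

open Classical in
/-- `F(r) = 𝔼[|g'(r)/g(r)|^{2-t} log^{β-1}|g(r)|]` with `g = f⁻¹`, the expectation being over the
event that `g` is defined at `r`, that is `r ∈ f(𝔻₋)`. -/
def F (P : Measure Ω) (f : Ω → ℂ → ℂ) (t β r : ℝ) : ℝ≥0∞ :=
  ∫⁻ ω, (if (r : ℂ) ∈ f ω '' extDisc then
    ENNReal.ofReal
      (‖deriv (inverse (f ω)) (r : ℂ) / inverse (f ω) (r : ℂ)‖ ^ (2 - t) *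
        Real.log ‖inverse (f ω) (r : ℂ)‖ ^ (β - 1))
    else 0) ∂P

/-- The functions on `(1, ∞)` that belong to `L¹(1, R)` for every `R > 1`. -/
def ClassL (h : ℝ → ℝ≥0∞) : Prop :=
  ∀ R, 1 < R → AEMeasurable h (volume.restrict (Set.Ioo 1 R)) ∧ ∫⁻ r in Set.Ioo 1 R, h r < ∞

end Snowflake

end

/-! Shifting every angle θ_j by k^j α turns f(z) into e^{iα} f(e^{-iα} z) and preserves the law of
independent uniform angles. Hence the mean of |f'|^t depends only on |z|, and the mean of the
integrand of `F` only on |w|: radial integrals of means are means of planar integrals, up to the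
harmless polar factor r. In the plane substitute w = f(z). The Jacobian |f'|^2 and |g'/g|^{2-t} =
(|f'| |z|)^{t-2} combine to |f'|^t |z|^{t-2}, and log|z| is comparable to |z| - 1 on bounded annuli
(`lintegral_inverseMean_eq`, `exists_weight_comparison`). Since |z| ≤ |f(z)| ≤ M|z|, cutting off at
|w| < R or at |z| < R makes no difference once all R are considered. So `F` is locally integrable up
to 1 exactly when the radial integral of E|f'|^t converges. Convergence does not depend on R and
persists when β grows, so the divergent and the convergent β form a cut of the line, whose sup and
inf agree.

The analytic input is `exists_isConformalFamily`. With L a logarithm of φ(w)/w, the Koebe transforms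
are z exp(L(e^{-iθ} z^n)/n). Bounds on Re L control moduli, the factor 1/n gives geometric
convergence uniformly in the angles, and Hurwitz' theorem gives injectivity of the limit. -/

namespace Snowflake

/-! ### Univalent functions: nonvanishing derivative and Hurwitz' theorem. -/

/-- At a zero of order m ≥ 2, f - f(z) is c κ^m with κ a local homeomorphism. For ω a primitive m-th
root of unity, κ attains both w and ωw near 0, at two distinct points with the same image under f.
-/
theorem deriv_ne_zero_of_injOn {f : ℂ → ℂ} {U : Set ℂ} (hU : IsOpen U)
    (hf : DifferentiableOn ℂ f U) (hi : Set.InjOn f U) {z : ℂ} (hz : z ∈ U) : deriv f z ≠ 0 := by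
  intro hd
  have ha : AnalyticAt ℂ f z := hf.analyticAt (hU.mem_nhds hz)
  have ha' : AnalyticAt ℂ (fun w => f w - f z) z := ha.sub analyticAt_const
  have hnc : ¬ ∀ᶠ w in 𝓝 z, f w - f z = 0 := by
    intro h
    have h1 : ∀ᶠ w in 𝓝[≠] z, f w - f z = 0 ∧ w ∈ U :=
      (h.and (hU.mem_nhds hz)).filter_mono nhdsWithin_le_nhds
    obtain ⟨w, ⟨hw, hwU⟩, hwz⟩ := (h1.and self_mem_nhdsWithin).exists
    exact hwz (hi hwU hz (sub_eq_zero.1 hw))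
  obtain ⟨m, g, hg, hg0, hfg⟩ := (ha'.exists_eventuallyEq_pow_smul_nonzero_iff).2 hnc
  have hm1 : m ≠ 1 := by
    rintro rfl
    have hD : HasDerivAt (fun w => (w - z) ^ 1 • g w) (g z) z := by
      simpa using ((hasDerivAt_id z).sub_const z).fun_mul hg.differentiableAt.hasDerivAt
    have hD' : HasDerivAt (fun w => f w - f z) (g z) z := hD.congr_of_eventuallyEq hfg
    have := (ha.differentiableAt.hasDerivAt.sub_const (f z)).unique hD'
    exact hg0 (this ▸ hd)
  have hm0 : m ≠ 0 := by
    rintro rfl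
    have := hfg.self_of_nhds
    simp at this
    exact hg0 this.symm
  have hm : 2 ≤ m := by omega
  -- an `m`-th root of `f - f z`
  set c : ℂ := g z with hc
  let κ : ℂ → ℂ := fun w => (w - z) * (g w / c) ^ ((1 : ℂ) / m)
  have hκ : HasStrictDerivAt κ 1 z := by
    have hq : AnalyticAt ℂ (fun w => (g w / c) ^ ((1 : ℂ) / m)) z := by
      refine AnalyticAt.cpow (hg.div analyticAt_const hg0) analyticAt_const ?_
      rw [← hc, div_self hg0]
      exact Complex.one_mem_slitPlane
    have h1 := HasStrictDerivAt.fun_mul ((hasStrictDerivAt_id z).sub_const z) hq.hasStrictDerivAt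
    refine h1.congr_deriv ?_
    simp [← hc, div_self hg0]
  have hmap := hκ.map_nhds_eq one_ne_zero
  have hκz : κ z = 0 := by simp [κ]
  rw [hκz] at hmap
  have hgood : ∀ᶠ w in 𝓝 z, w ∈ U ∧ f w = f z + c * κ w ^ m := by
    filter_upwards [hU.mem_nhds hz, hfg] with w hw hw'
    refine ⟨hw, ?_⟩
    have : ((g w / c) ^ ((1 : ℂ) / m)) ^ m = g w / c := by
      rw [one_div, Complex.cpow_nat_inv_pow _ hm0]
    simp only [κ, mul_pow, this]
    rw [smul_eq_mul] at hw'
    field_simp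
    linear_combination hw'
  have him : κ '' {w | w ∈ U ∧ f w = f z + c * κ w ^ m} ∈ 𝓝 (0 : ℂ) := by
    rw [← hmap]; exact image_mem_map hgood
  let ω := Complex.exp (2 * π * Complex.I / m)
  have hω : IsPrimitiveRoot ω m := Complex.isPrimitiveRoot_exp m hm0
  have hω' : Tendsto (fun w : ℂ => ω * w) (𝓝 0) (𝓝 0) := by
    simpa using (continuous_const_mul ω).tendsto (0 : ℂ)
  have h2 : ∀ᶠ w in 𝓝[≠] (0 : ℂ), w ∈ κ '' {w | w ∈ U ∧ f w = f z + c * κ w ^ m} ∧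
      ω * w ∈ κ '' {w | w ∈ U ∧ f w = f z + c * κ w ^ m} :=
    ((show ∀ᶠ w in 𝓝 (0 : ℂ), _ from him).and (hω'.eventually him)).filter_mono nhdsWithin_le_nhds
  obtain ⟨w, ⟨⟨x, ⟨hxU, hx⟩, hxw⟩, ⟨y, ⟨hyU, hy⟩, hyw⟩⟩, hw0⟩ := (h2.and self_mem_nhdsWithin).exists
  have hxy : f x = f y := by
    rw [hx, hy, hxw, hyw, mul_pow, hω.pow_eq_one, one_mul]
  have : x = y := hi hxU hyU hxy
  subst this
  rw [hxw] at hyw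
  have hw0 : w ≠ 0 := hw0
  have : ω = 1 := by
    have : (ω - 1) * w = 0 := by linear_combination -hyw
    rcases mul_eq_zero.1 this with h | h
    · exact sub_eq_zero.1 h
    · exact absurd h hw0
  exact hω.ne_one (by omega) this

/-- **Hurwitz' theorem** for injective functions. -/
theorem injOn_of_tendstoLocallyUniformlyOn {ι : Type*} {l : Filter ι} [l.NeBot]
    {F : ι → ℂ → ℂ} {f : ℂ → ℂ} {U : Set ℂ} (hU : IsOpen U) (hUc : IsPreconnected U)
    (hF : ∀ n, DifferentiableOn ℂ (F n) U) (hinj : ∀ n, Set.InjOn (F n) U)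
    (hlim : TendstoLocallyUniformlyOn F f l U) (hnc : ∀ c, ∃ z ∈ U, f z ≠ c) :
    Set.InjOn f U := by
  have hf : DifferentiableOn ℂ f U := hlim.differentiableOn (Eventually.of_forall hF) hU
  have hfa : AnalyticOnNhd ℂ f U := hf.analyticOnNhd hU
  -- For large n, `F n` attains the value f(z) close to z.
  have key : ∀ z ∈ U, ∀ r > 0, ∃ s, 0 < s ∧ s < r ∧ ∀ᶠ n in l,
      ∃ w ∈ Metric.closedBall z s ∩ U, F n w = f z := by
    intro z hz r hr
    have h1 : ∀ᶠ w in 𝓝[≠] z, f w - f z ≠ 0 := by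
      have han : AnalyticAt ℂ (fun w => f w - f z) z := (hfa z hz).sub analyticAt_const
      refine han.eventually_eq_zero_or_eventually_ne_zero.resolve_left fun h => ?_
      obtain ⟨w, hw, hne⟩ := hnc (f z)
      exact hne (hfa.eqOn_of_preconnected_of_eventuallyEq analyticOnNhd_const hUc hz
        (h.mono fun w hw => sub_eq_zero.1 hw) hw)
    rw [eventually_nhdsWithin_iff] at h1
    obtain ⟨δ, hδ, hδ'⟩ := Metric.eventually_nhds_iff_ball.1 (h1.and (hU.mem_nhds hz))
    set s := min δ r / 2 with hs
    have hs0 : 0 < s := by positivity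
    have hsδ : s < δ := by have := min_le_left δ r; rw [hs]; linarith
    have hsr : s < r := by have := min_le_right δ r; rw [hs]; linarith
    have hsub : Metric.closedBall z s ⊆ U := fun w hw =>
      (hδ' w (Metric.closedBall_subset_ball hsδ hw)).2
    have hcs : IsCompact (Metric.sphere z s) := isCompact_sphere z s
    obtain ⟨x, hx, hmin⟩ := hcs.exists_isMinOn (NormedSpace.sphere_nonempty.2 hs0.le)
      (f := fun w => ‖f w - f z‖)
      (((hf.continuousOn.mono (Metric.sphere_subset_closedBall.trans hsub)).sub
        continuousOn_const).norm)
    set ε := ‖f x - f z‖ with hε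
    have hxne : x ≠ z := by
      rintro rfl
      simp at hx
      linarith
    have hε0 : 0 < ε :=
      norm_pos_iff.2 ((hδ' x (Metric.sphere_subset_closedBall.trans
        (Metric.closedBall_subset_ball hsδ) hx)).1 hxne)
    refine ⟨s, hs0, hsr, ?_⟩
    have hunif : TendstoUniformlyOn F f l (Metric.closedBall z s) :=
      (tendstoLocallyUniformlyOn_iff_forall_isCompact hU).1 hlim _ hsub (isCompact_closedBall z s)
    filter_upwards [Metric.tendstoUniformlyOn_iff.1 hunif (ε / 8) (by positivity)] with n hn
    have hzs : z ∈ Metric.closedBall z s := Metric.mem_closedBall_self hs0.le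
    have hz1 : ‖f z - F n z‖ < ε / 8 := by simpa [dist_eq_norm] using hn z hzs
    -- Quantitative open mapping: ε is the minimum of |f - f(z)| on the sphere, so an error ε/8
    -- leaves |F n w - F n z| ≥ ε/2 there. The image then covers the ball of radius ε/4 about F n z,
    -- which contains f(z).
    have hb := DiffContOnCl.ball_subset_image_closedBall (f := F n) (z₀ := z) (r := s)
      (ε := ε / 2) (((hF n).mono (by rwa [closure_ball _ hs0.ne'])).diffContOnCl) hs0 (by
        intro w hw
        have h2 : ε ≤ ‖f w - f z‖ := hmin hw
        have h3 : ‖f w - F n w‖ < ε / 8 := by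
          simpa [dist_eq_norm] using hn w (Metric.sphere_subset_closedBall hw)
        have h4 : ‖f w - f z‖ ≤ ‖f w - F n w‖ + ‖F n w - F n z‖ + ‖f z - F n z‖ := by
          calc ‖f w - f z‖ = ‖(f w - F n w) + (F n w - F n z) - (f z - F n z)‖ := by congr 1; ring
            _ ≤ ‖(f w - F n w) + (F n w - F n z)‖ + ‖f z - F n z‖ := norm_sub_le _ _
            _ ≤ _ := by gcongr; exact norm_add_le _ _
        linarith) (by
        have hne : F n x ≠ F n z := fun h => hxne (hinj n
          (hsub (Metric.sphere_subset_closedBall hx)) hz h)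
        by_contra hcon
        rw [not_frequently] at hcon
        have h5 : ∀ᶠ w in 𝓝[≠] z, F n w = F n z ∧ w ∈ U :=
          ((hcon.mono (fun w hw => not_not.1 hw)).and (hU.mem_nhds hz)).filter_mono
            nhdsWithin_le_nhds
        obtain ⟨w, ⟨hw, hwU⟩, hwz⟩ := (h5.and self_mem_nhdsWithin).exists
        exact hwz (hinj n hwU hz hw))
    obtain ⟨w, hw, hwe⟩ := hb (show f z ∈ Metric.ball (F n z) (ε / 2 / 2) by
      rw [Metric.mem_ball, dist_eq_norm]; linarith)
    exact ⟨w, ⟨hw, hsub hw⟩, hwe⟩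
  intro z hz z' hz' h
  by_contra hne
  have hd : 0 < dist z z' := dist_pos.2 hne
  -- Radii below half the distance keep the two closed balls disjoint, so injectivity of `F n` is
  -- violated.
  obtain ⟨s, hs0, hs, h1⟩ := key z hz (dist z z' / 2) (by positivity)
  obtain ⟨s', hs0', hs', h2⟩ := key z' hz' (dist z z' / 2) (by positivity)
  obtain ⟨n, ⟨w, ⟨hw, hwU⟩, hwe⟩, ⟨w', ⟨hw', hwU'⟩, hwe'⟩⟩ := (h1.and h2).exists
  have : w = w' := hinj n hwU hwU' (by rw [hwe, hwe', h])
  subst this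
  have := dist_triangle_left z z' w
  rw [Metric.mem_closedBall] at hw hw'
  linarith

/-! ### The exterior disc and the logarithm of φ(w)/w. -/

theorem isOpen_extDisc : IsOpen extDisc := isOpen_lt continuous_const continuous_norm

theorem ne_zero_of_mem_extDisc {z : ℂ} (hz : z ∈ extDisc) : z ≠ 0 := by
  rintro rfl
  have : (1 : ℝ) < ‖(0 : ℂ)‖ := hz
  simp at this
  linarith

theorem isPreconnected_extDisc : IsPreconnected extDisc := by
  -- The exterior disc is the exponential image of the convex right half-plane.
  have h : extDisc = Complex.exp '' {w | 0 < w.re} := by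
    ext z
    constructor
    · intro hz
      refine ⟨Complex.log z, ?_, Complex.exp_log (ne_zero_of_mem_extDisc hz)⟩
      simpa [Complex.log_re] using Real.log_pos hz
    · rintro ⟨w, hw, rfl⟩
      have hw : 0 < w.re := hw
      simpa [extDisc, Complex.norm_exp] using hw
  rw [h]
  exact ((convex_halfSpace_re_gt 0).isPreconnected).image _ Complex.continuous_exp.continuousOn

theorem eventually_mem_extDisc : ∀ᶠ z in Bornology.cobounded ℂ, z ∈ extDisc :=
  tendsto_norm_cobounded_atTop.eventually (eventually_gt_atTop 1)

/-- `L` is a holomorphic logarithm of `φ(w)/w` on the exterior disc, with real part in `[0, C]` and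
the value `log b` at infinity. -/
structure IsLogRep (φ L : ℂ → ℂ) (b : ℂ) (C : ℝ) : Prop where
  ne_zero : b ≠ 0
  holo : DifferentiableOn ℂ L extDisc
  eq : ∀ w ∈ extDisc, φ w = w * Complex.exp (L w)
  re_nonneg : ∀ w ∈ extDisc, 0 ≤ (L w).re
  re_le : ∀ w ∈ extDisc, (L w).re ≤ C
  bdd : ∀ ρ : ℝ, 1 < ρ → ∃ B : ℝ, ∀ w : ℂ, ρ ≤ ‖w‖ → ‖L w‖ ≤ B
  lim_div : Tendsto (fun z => φ z / z) (Bornology.cobounded ℂ) (𝓝 b)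
  lim : Tendsto L (Bornology.cobounded ℂ) (𝓝 (Complex.log b))

theorem inv_mem_extDisc {ζ : ℂ} (hζ : ζ ∈ Metric.ball (0 : ℂ) 1 \ {0}) : ζ⁻¹ ∈ extDisc := by
  have h0 : 0 < ‖ζ‖ := norm_pos_iff.2 hζ.2
  have h1 : ‖ζ‖ < 1 := by simpa using hζ.1
  change 1 < ‖ζ⁻¹‖
  rw [norm_inv]
  exact (one_lt_inv₀ h0).2 h1

theorem inv_mem_ball {w : ℂ} (hw : w ∈ extDisc) : w⁻¹ ∈ Metric.ball (0 : ℂ) 1 \ {0} := by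
  refine ⟨?_, by simpa using ne_zero_of_mem_extDisc hw⟩
  have h1 : 1 < ‖w‖ := hw
  rw [mem_ball_zero_iff, norm_inv]
  exact inv_lt_one_of_one_lt₀ h1

/-- A nonvanishing holomorphic function on a disc has a holomorphic logarithm. -/
theorem exists_log_of_ne_zero {u : ℂ → ℂ} {r : ℝ} (hr : 0 < r)
    (hu : DifferentiableOn ℂ u (Metric.ball 0 r)) (h0 : ∀ ζ ∈ Metric.ball (0 : ℂ) r, u ζ ≠ 0) :
    ∃ l : ℂ → ℂ, DifferentiableOn ℂ l (Metric.ball 0 r) ∧ l 0 = Complex.log (u 0) ∧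
      ∀ ζ ∈ Metric.ball (0 : ℂ) r, u ζ = Complex.exp (l ζ) := by
  have hq : DifferentiableOn ℂ (fun ζ => deriv u ζ / u ζ) (Metric.ball 0 r) :=
    (hu.deriv Metric.isOpen_ball).div hu h0
  obtain ⟨l, hl0, hl⟩ := hq.isExactOn_ball.with_val_at 0 (Complex.log (u 0))
  have hz : (0 : ℂ) ∈ Metric.ball (0 : ℂ) r := Metric.mem_ball_self hr
  refine ⟨l, fun ζ hζ => (hl ζ hζ).differentiableAt.differentiableWithinAt, hl0, ?_⟩
  have hd : ∀ ζ ∈ Metric.ball (0 : ℂ) r,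
      HasDerivAt (fun ζ => u ζ * Complex.exp (-l ζ)) 0 ζ := by
    intro ζ hζ
    have h1 := (hu.differentiableAt (Metric.isOpen_ball.mem_nhds hζ)).hasDerivAt
    refine (h1.fun_mul (hl ζ hζ).fun_neg.cexp).congr_deriv ?_
    have := h0 ζ hζ
    field_simp
    ring
  intro ζ hζ
  have hc := (convex_ball (0 : ℂ) r).is_const_of_fderivWithin_eq_zero (𝕜 := ℂ)
    (f := fun ζ => u ζ * Complex.exp (-l ζ))
    (fun x hx => (hd x hx).differentiableAt.differentiableWithinAt)
    (fun x hx => by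
      rw [fderivWithin_of_isOpen Metric.isOpen_ball hx]
      ext
      simpa using (hd x hx).deriv) hζ hz
  simp only [hl0, Complex.exp_neg, Complex.exp_log (h0 0 hz), mul_inv_cancel₀ (h0 0 hz)] at hc
  rwa [mul_inv_eq_one₀ (Complex.exp_ne_zero _)] at hc

/-- Schwarz' lemma for ψ(ζ) = 1/φ(1/ζ) gives |φ(w)| ≥ |w|, hence b ≠ 0 and Re L ≥ 0. The upper bound
on Re L, valid up to the unit circle, comes from univalence: ψ already covers a disc of radius δ on
|ζ| < 1/2, so |ψ| ≥ δ on the rest. -/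
theorem IsSigma'.exists_isLogRep {φ : ℂ → ℂ} (hφ : IsSigma' φ) :
    ∃ L b C, IsLogRep φ L b C := by
  obtain ⟨b', hb'⟩ := hφ.deriv_infty
  set b : ℂ := (b' : ℂ)
  have hball : Metric.ball (0 : ℂ) 1 ∈ 𝓝 0 := Metric.ball_mem_nhds 0 one_pos
  have hφinv : DifferentiableOn ℂ (fun ζ => φ ζ⁻¹) (Metric.ball 0 1 \ {0}) :=
    hφ.holo.comp (fun ζ hζ => (differentiableAt_inv hζ.2).differentiableWithinAt)
      (fun ζ hζ => inv_mem_extDisc hζ)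
  have hφne : ∀ w ∈ extDisc, φ w ≠ 0 := fun w hw => ne_zero_of_mem_extDisc (hφ.mapsTo hw)
  -- Schwarz' lemma
  let ψ : ℂ → ℂ := Function.update (fun ζ => (φ ζ⁻¹)⁻¹) 0 0
  have hψe : ∀ ζ ∈ Metric.ball (0 : ℂ) 1 \ {0}, ψ ζ = (φ ζ⁻¹)⁻¹ := fun ζ hζ => by
    simp only [ψ]; rw [Function.update_of_ne hζ.2]
  have hψ0 : ψ 0 = 0 := by simp [ψ]
  have hψd : DifferentiableOn ℂ ψ (Metric.ball 0 1) := by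
    rw [← Complex.differentiableOn_compl_singleton_and_continuousAt_iff hball]
    constructor
    · refine DifferentiableOn.congr (f := fun ζ => (φ ζ⁻¹)⁻¹) ?_ hψe
      exact hφinv.inv fun ζ hζ => hφne _ (inv_mem_extDisc hζ)
    · refine continuousAt_update_same.2 ?_
      exact tendsto_inv₀_cobounded.comp (hφ.infty.comp tendsto_inv₀_nhdsNE_zero)
  have hψm : Set.MapsTo ψ (Metric.ball 0 1) (Metric.closedBall 0 1) := by
    intro ζ hζ
    by_cases h : ζ = 0
    · subst h; rw [hψ0]; simp
    · rw [hψe ζ ⟨hζ, h⟩]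
      exact Metric.ball_subset_closedBall (inv_mem_ball (hφ.mapsTo (inv_mem_extDisc ⟨hζ, h⟩))).1
  have hle : ∀ w ∈ extDisc, ‖w‖ ≤ ‖φ w‖ := by
    intro w hw
    have h1 := inv_mem_ball hw
    have h2 := Complex.norm_le_norm_of_mapsTo_ball hψd hψm hψ0 (mem_ball_zero_iff.1 h1.1)
    rw [hψe _ h1, inv_inv, norm_inv, norm_inv] at h2
    exact (inv_le_inv₀ (norm_pos_iff.2 (hφne w hw))
      (norm_pos_iff.2 (ne_zero_of_mem_extDisc hw))).1 h2
  have hb1 : 1 ≤ ‖b‖ := by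
    refine ge_of_tendsto hb'.norm ?_
    filter_upwards [eventually_mem_extDisc] with w hw
    rw [norm_div, one_le_div (norm_pos_iff.2 (ne_zero_of_mem_extDisc hw))]
    exact hle w hw
  have hb0 : b ≠ 0 := norm_pos_iff.1 (by linarith)
  -- the function `ζ φ(1/ζ)`
  let u : ℂ → ℂ := Function.update (fun ζ => ζ * φ ζ⁻¹) 0 b
  have hue : ∀ ζ ∈ Metric.ball (0 : ℂ) 1 \ {0}, u ζ = ζ * φ ζ⁻¹ := fun ζ hζ => by
    simp only [u]; rw [Function.update_of_ne hζ.2]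
  have hu0 : u 0 = b := by simp [u]
  have hud : DifferentiableOn ℂ u (Metric.ball 0 1) := by
    rw [← Complex.differentiableOn_compl_singleton_and_continuousAt_iff hball]
    constructor
    · exact (differentiableOn_id.mul hφinv).congr hue
    · refine continuousAt_update_same.2 ?_
      refine (hb'.comp tendsto_inv₀_nhdsNE_zero).congr fun ζ => ?_
      simp [div_eq_mul_inv, mul_comm]
  have hu1 : ∀ ζ ∈ Metric.ball (0 : ℂ) 1, 1 ≤ ‖u ζ‖ := by
    intro ζ hζ
    by_cases h : ζ = 0
    · rw [h, hu0]; exact hb1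
    · rw [hue ζ ⟨hζ, h⟩, norm_mul]
      have h2 := hle _ (inv_mem_extDisc ⟨hζ, h⟩)
      have h3 : 0 < ‖ζ‖ := norm_pos_iff.2 h
      rw [norm_inv] at h2
      calc (1 : ℝ) = ‖ζ‖ * ‖ζ‖⁻¹ := (mul_inv_cancel₀ h3.ne').symm
        _ ≤ _ := by gcongr
  obtain ⟨l, hld, hl0, hl⟩ := exists_log_of_ne_zero one_pos hud fun ζ hζ =>
    norm_pos_iff.1 (by linarith [hu1 ζ hζ])
  rw [hu0] at hl0
  have hre : ∀ ζ ∈ Metric.ball (0 : ℂ) 1, (l ζ).re = Real.log ‖u ζ‖ := fun ζ hζ => by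
    rw [hl ζ hζ, Complex.norm_exp, Real.log_exp]
  -- `φ` maps bounded sets to bounded sets
  have hψu : ∀ ζ ∈ Metric.ball (0 : ℂ) 1, ψ ζ = ζ * Complex.exp (-l ζ) := by
    intro ζ hζ
    rw [Complex.exp_neg, ← hl ζ hζ]
    by_cases h : ζ = 0
    · subst h; simp [hψ0]
    · rw [hψe ζ ⟨hζ, h⟩, hue ζ ⟨hζ, h⟩]
      have := hφne _ (inv_mem_extDisc ⟨hζ, h⟩)
      field_simp
  have hψi : Set.InjOn ψ (Metric.ball 0 1) := by
    have hne : ∀ ζ ∈ Metric.ball (0 : ℂ) 1, ζ ≠ 0 → ψ ζ ≠ 0 := fun ζ hζ h => by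
      rw [hψu ζ hζ]; exact mul_ne_zero h (Complex.exp_ne_zero _)
    intro x hx y hy h
    by_cases hx0 : x = 0
    · by_contra hxy
      refine hne y hy (fun h' => hxy (hx0.trans h'.symm)) ?_
      rw [← h, hx0, hψ0]
    · by_cases hy0 : y = 0
      · exact absurd (by rw [h, hy0, hψ0]) (hne x hx hx0)
      · rw [hψe x ⟨hx, hx0⟩, hψe y ⟨hy, hy0⟩] at h
        exact inv_injective (hφ.inj (inv_mem_extDisc ⟨hx, hx0⟩) (inv_mem_extDisc ⟨hy, hy0⟩)
          (inv_injective h))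
  have hψs : HasStrictDerivAt ψ (deriv ψ 0) 0 :=
    (hψd.analyticAt hball).hasStrictDerivAt
  have hnhds := hψs.map_nhds_eq (deriv_ne_zero_of_injOn Metric.isOpen_ball hψd hψi
    (Metric.mem_ball_self one_pos))
  have him : ψ '' Metric.ball 0 (1 / 2) ∈ 𝓝 (0 : ℂ) := by
    rw [hψ0] at hnhds
    rw [← hnhds]
    exact image_mem_map (Metric.ball_mem_nhds 0 (by norm_num))
  obtain ⟨δ, hδ, hδ'⟩ := Metric.mem_nhds_iff.1 him
  have hcomp : ∀ r : ℝ, r < 1 → Metric.closedBall (0 : ℂ) r ⊆ Metric.ball 0 1 := fun r hr =>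
    Metric.closedBall_subset_ball hr
  obtain ⟨M, hM⟩ := (isCompact_closedBall (0 : ℂ) (1 / 2)).exists_bound_of_continuousOn
    (hud.continuousOn.mono (hcomp (1 / 2) (by norm_num)))
  have hub : ∀ ζ ∈ Metric.ball (0 : ℂ) 1, ‖u ζ‖ ≤ max M (1 / δ) := by
    intro ζ hζ
    by_cases h : ‖ζ‖ ≤ 1 / 2
    · exact (hM ζ (by simpa using h)).trans (le_max_left _ _)
    · push Not at h
      have h1 : δ ≤ ‖ψ ζ‖ := by
        by_contra hlt
        push Not at hlt
        obtain ⟨x, hx, hxe⟩ := hδ' (show ψ ζ ∈ Metric.ball 0 δ by simpa using hlt)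
        have := hψi (Metric.ball_subset_ball (by norm_num) hx) hζ hxe
        rw [this] at hx
        have : ‖ζ‖ < 1 / 2 := by simpa using hx
        linarith
      have h0 : ζ ≠ 0 := norm_pos_iff.1 (by linarith)
      refine le_trans ?_ (le_max_right _ _)
      rw [hψe ζ ⟨hζ, h0⟩, norm_inv] at h1
      rw [hue ζ ⟨hζ, h0⟩, norm_mul]
      have h2 : ‖φ ζ⁻¹‖ ≤ 1 / δ := by
        rw [one_div]; exact (le_inv_comm₀ hδ (norm_pos_iff.2
          (hφne _ (inv_mem_extDisc ⟨hζ, h0⟩)))).1 h1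
      have h3 : ‖ζ‖ < 1 := by simpa using hζ
      calc ‖ζ‖ * ‖φ ζ⁻¹‖ ≤ 1 * (1 / δ) := by gcongr
        _ = _ := one_mul _
  refine ⟨fun w => l w⁻¹, b, Real.log (max M (1 / δ)), hb0, ?_, ?_, ?_, ?_, ?_, hb', ?_⟩
  · exact hld.comp (fun w hw => (differentiableAt_inv
      (ne_zero_of_mem_extDisc hw)).differentiableWithinAt) fun w hw => (inv_mem_ball hw).1
  · intro w hw
    have h := inv_mem_ball hw
    rw [← hl _ h.1, hue _ h, inv_inv, mul_inv_cancel_left₀ (ne_zero_of_mem_extDisc hw)]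
  · intro w hw
    have h := (inv_mem_ball hw).1
    rw [hre _ h]
    exact Real.log_nonneg (hu1 _ h)
  · intro w hw
    have h := (inv_mem_ball hw).1
    rw [hre _ h]
    exact Real.log_le_log (by linarith [hu1 _ h]) (hub _ h)
  · intro ρ hρ
    have hρ' : ρ⁻¹ < 1 := inv_lt_one_of_one_lt₀ hρ
    obtain ⟨B, hB⟩ := (isCompact_closedBall (0 : ℂ) ρ⁻¹).exists_bound_of_continuousOn
      (hld.continuousOn.mono (hcomp _ hρ'))
    refine ⟨B, fun w hw => hB _ ?_⟩
    rw [mem_closedBall_zero_iff, norm_inv]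
    exact inv_anti₀ (by linarith) hw
  · have hc : ContinuousAt l 0 := hld.continuousOn.continuousAt hball
    rw [ContinuousAt, hl0] at hc
    exact hc.comp tendsto_inv₀_cobounded

/-! ### Rotations and explicit Koebe transforms. -/

theorem norm_expI (a : Torus) : ‖expI a‖ = 1 := Circle.norm_coe _

theorem expI_ne_zero (a : Torus) : expI a ≠ 0 := norm_pos_iff.1 (by rw [norm_expI]; exact one_pos)

theorem continuous_expI : Continuous expI :=
  continuous_subtype_val.comp AddCircle.continuous_toCircle

theorem expI_add (a c : Torus) : expI (a + c) = expI a * expI c := by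
  simp [expI, AddCircle.toCircle_add]

theorem expI_neg (a : Torus) : expI (-a) = (expI a)⁻¹ := by
  simp [expI, AddCircle.toCircle_neg]

theorem expI_nsmul (n : ℕ) (a : Torus) : expI (n • a) = expI a ^ n := by
  simp [expI, AddCircle.toCircle_nsmul]

theorem expI_coe (s : ℝ) : expI (s : Torus) = Complex.exp (s * Complex.I) := by
  have h : 2 * π / (2 * π) = 1 := div_self Real.two_pi_pos.ne'
  rw [expI, AddCircle.toCircle_apply_mk, h, one_mul, Circle.coe_exp]

theorem expI_mul_mem {z : ℂ} (hz : z ∈ extDisc) (a : Torus) : expI a * z ∈ extDisc := by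
  change 1 < ‖expI a * z‖
  rw [norm_mul, norm_expI, one_mul]; exact hz

theorem pow_mem_extDisc {z : ℂ} (hz : z ∈ extDisc) {n : ℕ} (hn : n ≠ 0) : z ^ n ∈ extDisc := by
  change 1 < ‖z ^ n‖
  rw [norm_pow]; exact one_lt_pow₀ hz hn

/-- The formula `z exp(L(e^{-iθ}z^n)/n)` for the Koebe transform of the rotation `φ_θ`. -/
noncomputable def root (L : ℂ → ℂ) (n : ℕ) (a : Torus) (z : ℂ) : ℂ :=
  z * Complex.exp (L (expI (-a) * z ^ n) / n)

section root

variable {φ L : ℂ → ℂ} {b : ℂ} {C : ℝ}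

theorem rot_arg_mem {z : ℂ} (hz : z ∈ extDisc) {n : ℕ} (hn : n ≠ 0) (a : Torus) :
    expI (-a) * z ^ n ∈ extDisc := expI_mul_mem (pow_mem_extDisc hz hn) _

theorem IsLogRep.rot_eq (h : IsLogRep φ L b C) (a : Torus) {z : ℂ} (hz : z ∈ extDisc) :
    rot φ a z = z * Complex.exp (L (expI (-a) * z)) := by
  rw [rot, h.eq _ (expI_mul_mem hz _), expI_neg]
  have := expI_ne_zero a
  field_simp

theorem IsLogRep.differentiableOn_root (h : IsLogRep φ L b C) {n : ℕ} (hn : n ≠ 0) (a : Torus) :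
    DifferentiableOn ℂ (root L n a) extDisc := by
  refine differentiableOn_id.mul (DifferentiableOn.cexp (DifferentiableOn.div_const ?_ _))
  refine h.holo.comp (by fun_prop) fun z hz => rot_arg_mem hz hn a

theorem root_pow {z : ℂ} {n : ℕ} (hn : n ≠ 0) (a : Torus) :
    root L n a z ^ n = z ^ n * Complex.exp (L (expI (-a) * z ^ n)) := by
  rw [root, mul_pow, ← Complex.exp_nat_mul, mul_div_cancel₀ _ (Nat.cast_ne_zero.2 hn)]

theorem tendsto_expI_mul_cobounded (a : Torus) :
    Tendsto (fun z => expI a * z) (Bornology.cobounded ℂ) (Bornology.cobounded ℂ) := by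
  rw [← tendsto_norm_atTop_iff_cobounded]
  simpa [norm_expI] using tendsto_norm_cobounded_atTop (E := ℂ)

theorem tendsto_pow_cobounded {n : ℕ} (hn : n ≠ 0) :
    Tendsto (fun z : ℂ => z ^ n) (Bornology.cobounded ℂ) (Bornology.cobounded ℂ) := by
  rw [← tendsto_norm_atTop_iff_cobounded]
  simp only [norm_pow]
  exact (tendsto_pow_atTop hn).comp tendsto_norm_cobounded_atTop

/-- Dividing the logarithm by n selects a holomorphic root, and L(∞) = log b makes it the principal
one at infinity. In particular the choice in `koebe` is not vacuous. -/
theorem IsLogRep.isKoebe_root (h : IsLogRep φ L b C) {n : ℕ} (hn : n ≠ 0) (a : Torus) :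
    IsKoebe n (rot φ a) (root L n a) where
  holo := h.differentiableOn_root hn a
  pow_eq z hz := by rw [root_pow hn, h.rot_eq a (pow_mem_extDisc hz hn)]
  branch := by
    refine ⟨b, ?_, ?_⟩
    · refine (h.lim_div.comp (tendsto_expI_mul_cobounded (-a))).congr fun z => ?_
      have := expI_ne_zero a
      simp only [Function.comp, rot, expI_neg]
      field_simp
    · rw [Complex.cpow_def_of_ne_zero h.ne_zero, mul_one_div]
      have h1 : Tendsto (fun z => Complex.exp (L (expI (-a) * z ^ n) / n)) (Bornology.cobounded ℂ)
          (𝓝 (Complex.exp (Complex.log b / n))) :=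
        (Complex.continuous_exp.tendsto _).comp ((h.lim.comp ((tendsto_expI_mul_cobounded _).comp
          (tendsto_pow_cobounded hn))).div_const _)
      refine h1.congr' ?_
      filter_upwards [eventually_mem_extDisc] with z hz
      rw [root, mul_div_cancel_left₀ _ (ne_zero_of_mem_extDisc hz)]

theorem root_ne_zero {n : ℕ} (a : Torus) {z : ℂ} (hz : z ∈ extDisc) : root L n a z ≠ 0 :=
  mul_ne_zero (ne_zero_of_mem_extDisc hz) (Complex.exp_ne_zero _)

/-- A continuous function with `q ^ n = 1` on a preconnected set is constant. -/
theorem eqOn_const_of_pow_eq_one {q : ℂ → ℂ} {U : Set ℂ} (hU : IsPreconnected U)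
    (hq : ContinuousOn q U) {n : ℕ} (hn : n ≠ 0) (h1 : ∀ z ∈ U, q z ^ n = 1) {x y : ℂ}
    (hx : x ∈ U) (hy : y ∈ U) : q x = q y := by
  have hfin : (q '' U).Finite := by
    refine (Polynomial.nthRootsFinset n (1 : ℂ)).finite_toSet.subset ?_
    rintro _ ⟨z, hz, rfl⟩
    simpa [Polynomial.mem_nthRootsFinset (Nat.pos_of_ne_zero hn)] using h1 z hz
  have hs : (q '' U).Subsingleton := by
    by_contra hne
    exact (hU.image q hq).infinite_of_nontrivial (Set.not_subsingleton_iff.1 hne) hfin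
  exact hs ⟨x, hx, rfl⟩ ⟨y, hy, rfl⟩

/-- The quotient of two candidates has n-th power 1, hence is constant on the connected exterior
disc, and its limit at infinity is 1. -/
theorem IsLogRep.koebe_rot_eq (h : IsLogRep φ L b C) {n : ℕ} (hn : n ≠ 0) (a : Torus) {z : ℂ}
    (hz : z ∈ extDisc) : koebe n (rot φ a) z = root L n a z := by
  have hr := h.isKoebe_root hn a
  have hk : IsKoebe n (rot φ a) (koebe n (rot φ a)) := Classical.epsilon_spec ⟨_, hr⟩
  set Φ := koebe n (rot φ a)
  obtain ⟨b₁, hb₁, hΦ⟩ := hk.branch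
  obtain ⟨b₂, hb₂, hR⟩ := hr.branch
  have hb : b₁ = b := by
    have h3 : Tendsto (fun z => rot φ a z / z) (Bornology.cobounded ℂ) (𝓝 b) := by
      refine (h.lim_div.comp (tendsto_expI_mul_cobounded (-a))).congr fun z => ?_
      have := expI_ne_zero a
      simp only [Function.comp, rot, expI_neg]
      field_simp
    exact tendsto_nhds_unique hb₁ h3
  have hb' : b₂ = b₁ := tendsto_nhds_unique hb₂ hb₁
  subst hb hb'
  have hne : b₂ ^ ((1 : ℂ) / n) ≠ 0 := by
    rw [Complex.cpow_def_of_ne_zero h.ne_zero]; exact Complex.exp_ne_zero _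
  have hlim : Tendsto (fun z => Φ z / root L n a z) (Bornology.cobounded ℂ) (𝓝 1) := by
    have := hΦ.div hR hne
    rw [div_self hne] at this
    refine this.congr' ?_
    filter_upwards [eventually_mem_extDisc] with z hz
    exact div_div_div_cancel_right₀ (ne_zero_of_mem_extDisc hz) _ _
  have hconst : ∀ w ∈ extDisc, Φ w / root L n a w = Φ z / root L n a z := fun w hw =>
    eqOn_const_of_pow_eq_one isPreconnected_extDisc
      (hk.holo.continuousOn.div hr.holo.continuousOn fun w hw => root_ne_zero a hw) hn
      (fun w hw => by
        rw [Pi.div_apply, div_pow, hk.pow_eq w hw, hr.pow_eq w hw, div_self]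
        rw [← hr.pow_eq w hw]
        exact pow_ne_zero _ (root_ne_zero a hw)) hw hz
  have h1 : Φ z / root L n a z = 1 :=
    tendsto_nhds_unique (tendsto_const_nhds.congr' (by
      filter_upwards [eventually_mem_extDisc] with w hw using (hconst w hw).symm)) hlim
  exact (div_eq_one_iff_eq (root_ne_zero a hz)).1 h1

theorem norm_root {n : ℕ} (a : Torus) (z : ℂ) :
    ‖root L n a z‖ = ‖z‖ * Real.exp ((L (expI (-a) * z ^ n)).re / n) := by
  rw [root, norm_mul, Complex.norm_exp]
  congr 2
  exact Complex.div_natCast_re _ _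

theorem IsLogRep.le_norm_root (h : IsLogRep φ L b C) {n : ℕ} (hn : n ≠ 0) (a : Torus) {z : ℂ}
    (hz : z ∈ extDisc) : ‖z‖ ≤ ‖root L n a z‖ := by
  rw [norm_root]
  have := h.re_nonneg _ (rot_arg_mem hz hn a)
  exact le_mul_of_one_le_right (norm_nonneg _) (Real.one_le_exp (by positivity))

theorem IsLogRep.norm_root_le (h : IsLogRep φ L b C) {n : ℕ} (hn : n ≠ 0) (a : Torus) {z : ℂ}
    (hz : z ∈ extDisc) : ‖root L n a z‖ ≤ ‖z‖ * Real.exp (C / n) := by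
  rw [norm_root]
  have := h.re_le _ (rot_arg_mem hz hn a)
  gcongr

theorem IsLogRep.root_mem (h : IsLogRep φ L b C) {n : ℕ} (hn : n ≠ 0) (a : Torus) {z : ℂ}
    (hz : z ∈ extDisc) : root L n a z ∈ extDisc :=
  lt_of_lt_of_le (show 1 < ‖z‖ from hz) (h.le_norm_root hn a hz)

/-- Equal values have equal n-th powers, so univalence of φ identifies the arguments of L. The
exponential factors then coincide and cancel. -/
theorem IsLogRep.injOn_root (h : IsLogRep φ L b C) (hφ : Set.InjOn φ extDisc) {n : ℕ}
    (hn : n ≠ 0) (a : Torus) : Set.InjOn (root L n a) extDisc := by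
  intro x hx y hy hxy
  have h1 : φ (expI (-a) * x ^ n) = φ (expI (-a) * y ^ n) := by
    have := congrArg (· ^ n) hxy
    simp only [root_pow hn] at this
    rw [h.eq _ (rot_arg_mem hx hn a), h.eq _ (rot_arg_mem hy hn a), mul_assoc, this, mul_assoc]
  have h2 := hφ (rot_arg_mem hx hn a) (rot_arg_mem hy hn a) h1
  rw [root, root, h2] at hxy
  exact mul_right_cancel₀ (Complex.exp_ne_zero _) hxy

/-- The argument of L is unchanged, since the shift n • c of the angle cancels the factor that
(e^{ic} z)^n acquires. -/
theorem root_add (n : ℕ) (a c : Torus) (z : ℂ) :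
    root L n (a + n • c) (expI c * z) = expI c * root L n a z := by
  have h : expI (-(a + n • c)) * (expI c * z) ^ n = expI (-a) * z ^ n := by
    have := expI_ne_zero c
    rw [expI_neg, expI_add, expI_nsmul, expI_neg, mul_pow]
    field_simp
  rw [root, root, h, mul_assoc]

theorem IsLogRep.continuousOn_root (h : IsLogRep φ L b C) {n : ℕ} (hn : n ≠ 0) :
    ContinuousOn (fun p : Torus × ℂ => root L n p.1 p.2) (Set.univ ×ˢ extDisc) := by
  have h1 : ContinuousOn (fun p : Torus × ℂ => L (expI (-p.1) * p.2 ^ n))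
      (Set.univ ×ˢ extDisc) := by
    refine h.holo.continuousOn.comp ?_ fun p hp => rot_arg_mem hp.2 hn p.1
    exact ((continuous_expI.comp continuous_fst.neg).mul
      (continuous_snd.pow n)).continuousOn
  exact continuous_snd.continuousOn.mul (h1.div_const _).cexp

/-- The Koebe transforms are close to the identity. -/
theorem IsLogRep.exists_norm_root_sub_le (h : IsLogRep φ L b C) {ρ : ℝ} (hρ : 1 < ρ) :
    ∃ B, 0 ≤ B ∧ ∀ (n : ℕ) (_ : n ≠ 0) (a : Torus) (z : ℂ), ρ ≤ ‖z‖ →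
      ‖root L n a z - z‖ ≤ ‖z‖ * (B / n) := by
  obtain ⟨B, hB⟩ := h.bdd ρ hρ
  have hB0 : 0 ≤ B := (norm_nonneg _).trans (hB (ρ : ℂ) (by
    rw [Complex.norm_real]; exact le_abs_self ρ))
  -- From |e^v - 1| ≤ |v| e^{|v|} with v = L/n and |v| ≤ B/n ≤ B.
  refine ⟨B * Real.exp B, by positivity, fun n hn a z hz => ?_⟩
  have hn0 : (0 : ℝ) < n := by positivity
  have hn1 : (1 : ℝ) ≤ n := by exact_mod_cast Nat.one_le_iff_ne_zero.2 hn
  have hz1 : 1 < ‖z‖ := lt_of_lt_of_le hρ hz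
  have hL : ‖L (expI (-a) * z ^ n)‖ ≤ B := by
    refine hB _ ?_
    rw [norm_mul, norm_expI, one_mul, norm_pow]
    exact hz.trans (le_self_pow₀ hz1.le hn)
  set v := L (expI (-a) * z ^ n) / n with hv
  have hvn : ‖v‖ ≤ B / n := by
    rw [hv, norm_div, Complex.norm_natCast]; gcongr
  have hvB : ‖v‖ ≤ B := hvn.trans (div_le_self hB0 hn1)
  have he : ‖Complex.exp v - 1‖ ≤ ‖v‖ * Real.exp ‖v‖ := by
    simpa using Complex.norm_exp_sub_sum_le_norm_mul_exp v 1
  have : root L n a z - z = z * (Complex.exp v - 1) := by rw [root]; ring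
  rw [this, norm_mul]
  gcongr
  calc _ ≤ ‖v‖ * Real.exp ‖v‖ := he
    _ ≤ B / n * Real.exp B := by gcongr
    _ = _ := by ring

end root

/-! ### The approximations: moduli, equivariance, geometric convergence. -/

/-- The approximations of the snowflake in terms of the logarithm `L` of the building block. -/
noncomputable def rootApprox (L : ℂ → ℂ) (k : ℕ) (θ : ℕ → Torus) : ℕ → ℂ → ℂ
  | 0 => root L 1 (θ 0)
  | n + 1 => rootApprox L k θ n ∘ root L (k ^ (n + 1)) (θ (n + 1))

section rootApprox

variable {φ L : ℂ → ℂ} {b : ℂ} {C : ℝ} {k : ℕ}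

theorem IsLogRep.approx_eq (h : IsLogRep φ L b C) (hk : 2 ≤ k) (θ : ℕ → Torus) (n : ℕ) {z : ℂ}
    (hz : z ∈ extDisc) : approx φ k θ n z = rootApprox L k θ n z := by
  induction n generalizing z with
  | zero => simp [approx, rootApprox, h.rot_eq _ hz, root]
  | succ n ih =>
    have hk0 : k ^ (n + 1) ≠ 0 := pow_ne_zero _ (by omega)
    rw [approx, rootApprox, Function.comp, Function.comp, h.koebe_rot_eq hk0 _ hz]
    exact ih (h.root_mem hk0 _ hz)

theorem IsLogRep.differentiableOn_rootApprox (h : IsLogRep φ L b C) (hk : 2 ≤ k) (θ : ℕ → Torus)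
    (n : ℕ) : DifferentiableOn ℂ (rootApprox L k θ n) extDisc := by
  induction n with
  | zero => exact h.differentiableOn_root one_ne_zero _
  | succ n ih =>
    have hk0 : k ^ (n + 1) ≠ 0 := pow_ne_zero _ (by omega)
    exact ih.comp (h.differentiableOn_root hk0 _) fun z hz => h.root_mem hk0 _ hz

theorem IsLogRep.injOn_rootApprox (h : IsLogRep φ L b C) (hφ : Set.InjOn φ extDisc) (hk : 2 ≤ k)
    (θ : ℕ → Torus) (n : ℕ) : Set.InjOn (rootApprox L k θ n) extDisc := by
  induction n with
  | zero => exact h.injOn_root hφ one_ne_zero _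
  | succ n ih =>
    have hk0 : k ^ (n + 1) ≠ 0 := pow_ne_zero _ (by omega)
    exact ih.comp (h.injOn_root hφ hk0 _) fun z hz => h.root_mem hk0 _ hz

theorem IsLogRep.continuousOn_rootApprox (h : IsLogRep φ L b C) (hk : 2 ≤ k) (n : ℕ) :
    ContinuousOn (fun p : (ℕ → Torus) × ℂ => rootApprox L k p.1 n p.2) (Set.univ ×ˢ extDisc) := by
  have hc : ∀ j m, m ≠ 0 → ContinuousOn (fun p : (ℕ → Torus) × ℂ => root L m (p.1 j) p.2)
      (Set.univ ×ˢ extDisc) := fun j m hm =>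
    (h.continuousOn_root hm).comp (f := fun p : (ℕ → Torus) × ℂ => (p.1 j, p.2))
      (by fun_prop) fun p hp => ⟨Set.mem_univ _, hp.2⟩
  induction n with
  | zero => exact hc 0 1 one_ne_zero
  | succ n ih =>
    have hk0 : k ^ (n + 1) ≠ 0 := pow_ne_zero _ (by omega)
    exact ih.comp (f := fun p : (ℕ → Torus) × ℂ => (p.1, root L (k ^ (n + 1)) (p.1 (n + 1)) p.2))
      (continuousOn_fst.prodMk (hc (n + 1) _ hk0))
      fun p hp => ⟨Set.mem_univ _, h.root_mem hk0 _ hp.2⟩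

theorem IsLogRep.le_norm_rootApprox (h : IsLogRep φ L b C) (hk : 2 ≤ k) (θ : ℕ → Torus) (n : ℕ)
    {z : ℂ} (hz : z ∈ extDisc) : ‖z‖ ≤ ‖rootApprox L k θ n z‖ := by
  induction n generalizing z with
  | zero => exact h.le_norm_root one_ne_zero _ hz
  | succ n ih =>
    have hk0 : k ^ (n + 1) ≠ 0 := pow_ne_zero _ (by omega)
    exact (h.le_norm_root hk0 _ hz).trans (ih (h.root_mem hk0 _ hz))

theorem two_mem_extDisc : (2 : ℂ) ∈ extDisc := by simp [extDisc]

theorem IsLogRep.nonneg (h : IsLogRep φ L b C) : 0 ≤ C :=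
  (h.re_nonneg 2 two_mem_extDisc).trans (h.re_le 2 two_mem_extDisc)

theorem two_pow_le_cast_pow (hk : 2 ≤ k) (n : ℕ) : (2 : ℝ) ^ n ≤ ((k ^ n : ℕ) : ℝ) := by
  push_cast
  exact pow_le_pow_left₀ (by norm_num) (by exact_mod_cast hk) n

theorem IsLogRep.norm_rootApprox_le (h : IsLogRep φ L b C) (hk : 2 ≤ k) (θ : ℕ → Torus) (n : ℕ)
    {z : ℂ} (hz : z ∈ extDisc) : ‖rootApprox L k θ n z‖ ≤ ‖z‖ * Real.exp (2 * C) := by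
  have hC := h.nonneg
  -- The j-th factor costs at most exp(C/k^j), and 2 - 1/2^n is the sum of 2^{-j} over j ≤ n.
  have key : ‖rootApprox L k θ n z‖ ≤ ‖z‖ * Real.exp (C * (2 - 1 / 2 ^ n)) := by
    induction n generalizing z with
    | zero =>
      have := h.norm_root_le one_ne_zero (θ 0) hz
      simp only [Nat.cast_one, div_one, pow_zero] at this ⊢
      norm_num
      exact this
    | succ n ih =>
      have hk0 : k ^ (n + 1) ≠ 0 := pow_ne_zero _ (by omega)
      have h1 : C / ((k ^ (n + 1) : ℕ) : ℝ) ≤ C * (1 / 2 ^ (n + 1)) := by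
        rw [mul_one_div]; gcongr; exact two_pow_le_cast_pow hk _
      calc ‖rootApprox L k θ (n + 1) z‖
          ≤ ‖root L (k ^ (n + 1)) (θ (n + 1)) z‖ * Real.exp (C * (2 - 1 / 2 ^ n)) :=
            ih (h.root_mem hk0 _ hz)
        _ ≤ ‖z‖ * Real.exp (C * (1 / 2 ^ (n + 1))) * Real.exp (C * (2 - 1 / 2 ^ n)) := by
            gcongr
            exact (h.norm_root_le hk0 _ hz).trans (by gcongr)
        _ = _ := by
            rw [mul_assoc, ← Real.exp_add]
            congr 2
            rw [pow_succ]
            field_simp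
            ring
  refine key.trans (mul_le_mul_of_nonneg_left (Real.exp_le_exp.2 ?_) (norm_nonneg _))
  have : 0 ≤ C * (1 / 2 ^ n) := by positivity
  linarith

theorem rootApprox_add (θ : ℕ → Torus) (n : ℕ) (α : Torus) (z : ℂ) :
    rootApprox L k (fun j => θ j + k ^ j • α) n (expI α * z) = expI α * rootApprox L k θ n z := by
  induction n generalizing z with
  | zero => simpa [rootApprox] using root_add (L := L) 1 (θ 0) α z
  | succ n ih =>
    rw [rootApprox, rootApprox, Function.comp, Function.comp, root_add]
    exact ih _

/-- Step n + 1 evaluates step n at a point w with |w - z| = O(2^{-n}), and the n-th approximations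
are Lipschitz near the annulus with a constant independent of n and θ, because they are uniformly
bounded. The form K / 2 / 2 ^ n suits the geometric Cauchy criterion with ratio 1/2. -/
theorem IsLogRep.exists_dist_rootApprox_le (h : IsLogRep φ L b C) (hk : 2 ≤ k) {ρ R : ℝ}
    (hρ : 1 < ρ) : ∃ K, ∀ (θ : ℕ → Torus) (n : ℕ) (z : ℂ), ρ ≤ ‖z‖ → ‖z‖ ≤ R →
      dist (rootApprox L k θ n z) (rootApprox L k θ (n + 1) z) ≤ K / 2 / 2 ^ n := by
  obtain ⟨B, hB0, hB⟩ := h.exists_norm_root_sub_le hρ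
  have hC := h.nonneg
  set δ := (ρ - 1) / 2 with hδ
  have hδ0 : 0 < δ := by rw [hδ]; linarith
  -- A bound on |v| ≤ R e^C + δ, a region containing w and the δ-ball about z.
  set M := (R * Real.exp C + δ) * Real.exp (2 * C) with hM
  refine ⟨2 * M / δ * (R * B), fun θ n z hz hzR => ?_⟩
  have hz1 : z ∈ extDisc := lt_of_lt_of_le hρ hz
  have hR : 0 ≤ R := (norm_nonneg z).trans hzR
  have hM0 : 0 ≤ M := by positivity
  have hk0 : k ^ (n + 1) ≠ 0 := pow_ne_zero _ (by omega)
  have hexp : 1 ≤ Real.exp C := Real.one_le_exp hC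
  have hbound : ∀ w ∈ extDisc, ‖w‖ ≤ R * Real.exp C + δ → ‖rootApprox L k θ n w‖ ≤ M :=
    fun w hw hwR => (h.norm_rootApprox_le hk θ n hw).trans (by rw [hM]; gcongr)
  have hRe : R ≤ R * Real.exp C := le_mul_of_one_le_right hR hexp
  have hzM := hbound z hz1 (by linarith)
  set w := root L (k ^ (n + 1)) (θ (n + 1)) z with hw
  have hw1 : w ∈ extDisc := h.root_mem hk0 _ hz1
  have hwM := hbound w hw1 (by
    have h1 : C / ((k ^ (n + 1) : ℕ) : ℝ) ≤ C :=
      div_le_self hC (by exact_mod_cast Nat.one_le_iff_ne_zero.2 hk0)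
    have h2 : ‖w‖ ≤ R * Real.exp C :=
      (h.norm_root_le hk0 _ hz1).trans (by gcongr)
    linarith)
  have hwz : dist w z ≤ R * B / 2 / 2 ^ n := by
    rw [dist_eq_norm]
    calc _ ≤ ‖z‖ * (B / ((k ^ (n + 1) : ℕ) : ℝ)) := hB _ hk0 _ _ hz
      _ ≤ R * (B / 2 ^ (n + 1)) := by gcongr; exact two_pow_le_cast_pow hk _
      _ = _ := by rw [pow_succ]; field_simp
  have hball : Metric.ball z δ ⊆ extDisc ∩ {v | ‖v‖ ≤ R * Real.exp C + δ} := by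
    intro v hv
    have h1 : ‖v - z‖ < δ := by simpa [dist_eq_norm] using hv
    have h2 : ‖v‖ ≤ ‖z‖ + ‖v - z‖ := by
      calc ‖v‖ = ‖z + (v - z)‖ := by congr 1; ring
        _ ≤ _ := norm_add_le _ _
    have h3 : ‖z‖ ≤ ‖v‖ + ‖v - z‖ := by
      calc ‖z‖ = ‖v - (v - z)‖ := by congr 1; ring
        _ ≤ _ := norm_sub_le _ _
    refine ⟨?_, ?_⟩
    · change 1 < ‖v‖; linarith
    · change ‖v‖ ≤ _; linarith
  have hmain : dist (rootApprox L k θ n w) (rootApprox L k θ n z) ≤ 2 * M / δ * dist w z := by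
    by_cases hd : dist w z < δ
    · refine Complex.dist_le_div_mul_dist_of_mapsTo_ball
        ((h.differentiableOn_rootApprox hk θ n).mono fun v hv => (hball hv).1) ?_ hd
      intro v hv
      rw [Metric.mem_closedBall, dist_eq_norm]
      have := hbound v (hball hv).1 (hball hv).2
      linarith [norm_sub_le (rootApprox L k θ n v) (rootApprox L k θ n z)]
    -- When w is at least δ away from z, the trivial bound 2M suffices.
    · push Not at hd
      rw [dist_eq_norm]
      calc _ ≤ ‖rootApprox L k θ n w‖ + ‖rootApprox L k θ n z‖ := norm_sub_le _ _
        _ ≤ 2 * M / δ * δ := by rw [div_mul_cancel₀ _ hδ0.ne']; linarith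
        _ ≤ _ := by gcongr
  rw [dist_comm]
  calc _ ≤ 2 * M / δ * dist w z := hmain
    _ ≤ 2 * M / δ * (R * B / 2 / 2 ^ n) := by gcongr
    _ = _ := by ring

end rootApprox

/-! ### The snowflake as an equivariant conformal family. -/

/-- A family of conformal maps of the exterior disc, depending continuously on a sequence of angles
and equivariant for the rotations. -/
structure IsConformalFamily (k : ℕ) (M : ℝ) (f : (ℕ → Torus) → ℂ → ℂ) : Prop where
  cont : ContinuousOn (fun p : (ℕ → Torus) × ℂ => f p.1 p.2) (Set.univ ×ˢ extDisc)
  holo : ∀ θ, DifferentiableOn ℂ (f θ) extDisc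
  inj : ∀ θ, Set.InjOn (f θ) extDisc
  lower : ∀ θ, ∀ z ∈ extDisc, ‖z‖ ≤ ‖f θ z‖
  upper : ∀ θ, ∀ z ∈ extDisc, ‖f θ z‖ ≤ ‖z‖ * M
  equivariant : ∀ θ α, ∀ z ∈ extDisc, f (fun j => θ j + k ^ j • α) (expI α * z) = expI α * f θ z

theorem IsSigma'.exists_isConformalFamily {φ : ℂ → ℂ} (hφ : IsSigma' φ) {k : ℕ} (hk : 2 ≤ k) :
    ∃ M, IsConformalFamily k M (snowflake φ k) := by
  obtain ⟨L, b, C, h⟩ := hφ.exists_isLogRep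
  have hlim : ∀ θ, ∀ z ∈ extDisc,
      Tendsto (fun n => rootApprox L k θ n z) atTop (𝓝 (snowflake φ k θ z)) := by
    intro θ z hz
    obtain ⟨K, hK⟩ := h.exists_dist_rootApprox_le hk (ρ := ‖z‖) (R := ‖z‖) hz
    have hc := cauchySeq_of_le_geometric_two (fun n => hK θ n z le_rfl le_rfl)
    have := hc.tendsto_limUnder
    rwa [snowflake, show (fun n => approx φ k θ n z) = fun n => rootApprox L k θ n z from
      funext fun n => h.approx_eq hk θ n hz]
  -- Uniformity in the angles as well as in z yields joint continuity of the limit.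
  have hunif : TendstoLocallyUniformlyOn
      (fun n (p : (ℕ → Torus) × ℂ) => rootApprox L k p.1 n p.2)
      (fun p => snowflake φ k p.1 p.2) atTop (Set.univ ×ˢ extDisc) := by
    rw [Metric.tendstoLocallyUniformlyOn_iff]
    rintro ε hε ⟨θ₀, z₀⟩ ⟨-, hz₀⟩
    have hz₀ : 1 < ‖z₀‖ := hz₀
    set ρ := (1 + ‖z₀‖) / 2 with hρ
    have hρ1 : 1 < ρ := by rw [hρ]; linarith
    obtain ⟨K, hK⟩ := h.exists_dist_rootApprox_le hk (ρ := ρ) (R := ‖z₀‖ + 1) hρ1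
    refine ⟨{p | ρ < ‖p.2‖ ∧ ‖p.2‖ < ‖z₀‖ + 1}, mem_nhdsWithin_of_mem_nhds ?_, ?_⟩
    · refine IsOpen.mem_nhds ?_ ⟨?_, ?_⟩
      · exact (isOpen_lt continuous_const continuous_snd.norm).inter
          (isOpen_lt continuous_snd.norm continuous_const)
      · change ρ < ‖z₀‖; rw [hρ]; linarith
      · change ‖z₀‖ < ‖z₀‖ + 1; linarith
    · have hK0 : Tendsto (fun n : ℕ => K / 2 ^ n) atTop (𝓝 0) :=
        tendsto_const_nhds.div_atTop (tendsto_pow_atTop_atTop_of_one_lt one_lt_two)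
      filter_upwards [hK0.eventually (gt_mem_nhds hε)] with n hn
      rintro ⟨θ, z⟩ ⟨h1, h2⟩
      rw [dist_comm]
      exact (dist_le_of_le_geometric_two_of_tendsto (fun n => hK θ n z h1.le h2.le)
        (hlim θ z (hρ1.trans h1)) n).trans_lt hn
  have hunif' : ∀ θ, TendstoLocallyUniformlyOn (rootApprox L k θ) (snowflake φ k θ) atTop
      extDisc := fun θ =>
    hunif.comp (fun z => (θ, z)) (fun z hz => ⟨Set.mem_univ _, hz⟩) (by fun_prop)
  have hlow : ∀ θ, ∀ z ∈ extDisc, ‖z‖ ≤ ‖snowflake φ k θ z‖ := fun θ z hz =>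
    ge_of_tendsto' (hlim θ z hz).norm fun n => h.le_norm_rootApprox hk θ n hz
  refine ⟨Real.exp (2 * C), ?_, ?_, ?_, hlow, ?_, ?_⟩
  · exact hunif.continuousOn (Frequently.of_forall fun n => h.continuousOn_rootApprox hk n)
  · exact fun θ => (hunif' θ).differentiableOn
      (Eventually.of_forall fun n => h.differentiableOn_rootApprox hk θ n) isOpen_extDisc
  · refine fun θ => injOn_of_tendstoLocallyUniformlyOn isOpen_extDisc isPreconnected_extDisc
      (h.differentiableOn_rootApprox hk θ) (h.injOn_rootApprox hφ.inj hk θ) (hunif' θ) fun c => ?_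
    -- The limit is not constantly c: at |c| + 2 its modulus is at least |c| + 2.
    have hmem : ((‖c‖ + 2 : ℝ) : ℂ) ∈ extDisc := by
      change 1 < ‖((‖c‖ + 2 : ℝ) : ℂ)‖
      rw [Complex.norm_real, Real.norm_of_nonneg (by positivity)]
      linarith [norm_nonneg c]
    refine ⟨_, hmem, fun hc => ?_⟩
    have := hlow θ _ hmem
    rw [hc, Complex.norm_real, Real.norm_of_nonneg (by positivity)] at this
    linarith
  · exact fun θ z hz => le_of_tendsto' (hlim θ z hz).norm fun n => h.norm_rootApprox_le hk θ n hz
  · intro θ α z hz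
    refine tendsto_nhds_unique (hlim _ _ (expI_mul_mem hz α)) ?_
    simp only [rootApprox_add]
    exact (hlim θ z hz).const_mul _

/-! ### The law of the angles and polar coordinates. -/

/-- The law of independent uniform angles. -/
noncomputable def angleLaw : Measure (ℕ → Torus) :=
  Measure.infinitePi fun _ => AddCircle.haarAddCircle

instance : IsProbabilityMeasure angleLaw := by unfold angleLaw; infer_instance

theorem measurePreserving_add_angleLaw (c : ℕ → Torus) :
    MeasurePreserving (fun θ : ℕ → Torus => fun j => θ j + c j) angleLaw angleLaw where
  measurable := by fun_prop
  map_eq := by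
    refine (Measure.infinitePi_map_pi (fun _ => AddCircle.haarAddCircle)
      (f := fun j (x : Torus) => x + c j) (by fun_prop)).trans ?_
    unfold angleLaw
    congr 1
    funext j
    exact map_add_right_eq_self _ _

theorem map_eq_angleLaw {Ω : Type*} [MeasurableSpace Ω] {P : Measure Ω} [IsProbabilityMeasure P]
    {θ : ℕ → Ω → Torus} (hindep : iIndepFun θ P)
    (hunif : ∀ n, HasLaw (θ n) AddCircle.haarAddCircle P) :
    P.map (fun ω n => θ n ω) = angleLaw := by
  rw [(iIndepFun_iff_map_fun_eq_infinitePi_map₀' fun n => (hunif n).aemeasurable).1 hindep,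
    angleLaw]
  congr 1
  funext n
  exact (hunif n).map_eq

/-- Integration in polar coordinates of the average of an equivariant function. -/
theorem lintegral_lintegral_eq_of_equivariant {k : ℕ} {J : (ℕ → Torus) × ℂ → ℝ≥0∞}
    (hJ : Measurable J)
    (hinv : ∀ θ α z, J ((fun j => θ j + k ^ j • α), expI α * z) = J (θ, z)) :
    ∫⁻ θ, (∫⁻ z, J (θ, z)) ∂angleLaw = ENNReal.ofReal (2 * π) *
      ∫⁻ r in Set.Ioi (0 : ℝ), ENNReal.ofReal r * ∫⁻ θ, J (θ, (r : ℂ)) ∂angleLaw := by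
  set Φ : ℂ → ℝ≥0∞ := fun z => ∫⁻ θ, J (θ, z) ∂angleLaw with hΦ
  have hΦm : Measurable Φ := hJ.lintegral_prod_left'
  -- Translating the angles by k^j α preserves their law and absorbs the rotation of z.
  have hΦi : ∀ α z, Φ (expI α * z) = Φ z := by
    intro α z
    have h1 : Measurable fun θ => J (θ, expI α * z) := hJ.comp measurable_prodMk_right
    rw [hΦ]
    simp only
    rw [← (measurePreserving_add_angleLaw fun j => k ^ j • α).lintegral_comp h1]
    exact lintegral_congr fun θ => hinv θ α z
  rw [lintegral_lintegral_swap (f := fun θ z => J (θ, z)) hJ.aemeasurable]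
  rw [← Complex.lintegral_comp_polarCoord_symm, polarCoord_target, Measure.volume_eq_prod,
    ← Measure.prod_restrict]
  have hcongr : ∀ p : ℝ × ℝ, ENNReal.ofReal p.1 • Φ (Complex.polarCoord.symm p) =
      (ENNReal.ofReal p.1 * Φ p.1) * 1 := by
    intro p
    have : Complex.polarCoord.symm p = expI ((p.2 : ℝ) : Torus) * (p.1 : ℂ) := by
      rw [Complex.polarCoord_symm_apply, expI_coe, Complex.exp_mul_I, mul_comm]
      push_cast; ring
    rw [this, hΦi, smul_eq_mul, mul_one]
  calc _ = ∫⁻ p : ℝ × ℝ, (ENNReal.ofReal p.1 * Φ p.1) * 1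
        ∂((volume.restrict (Set.Ioi 0)).prod (volume.restrict (Set.Ioo (-π) π))) :=
          lintegral_congr hcongr
    _ = (∫⁻ r in Set.Ioi (0 : ℝ), ENNReal.ofReal r * Φ r) *
          ∫⁻ _ in Set.Ioo (-π) π, 1 := by
        rw [lintegral_prod_mul (f := fun r : ℝ => ENNReal.ofReal r * Φ r) (g := fun _ => 1)]
        · exact (ENNReal.measurable_ofReal.mul
            (hΦm.comp Complex.measurable_ofReal)).aemeasurable
        · exact aemeasurable_const
    _ = _ := by
        rw [mul_comm, setLIntegral_one, Real.volume_Ioo]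
        congr 2
        ring

/-! ### Change of variables and the density of the inverse map. -/

theorem lintegral_image_eq_lintegral_norm_deriv_sq_mul {f : ℂ → ℂ} {U : Set ℂ} (hU : IsOpen U)
    (hf : DifferentiableOn ℂ f U) (hi : Set.InjOn f U) (g : ℂ → ℝ≥0∞) :
    ∫⁻ w in f '' U, g w = ∫⁻ z in U, ENNReal.ofReal (‖deriv f z‖ ^ 2) * g (f z) := by
  rw [lintegral_image_eq_lintegral_abs_det_fderiv_mul volume hU.measurableSet
    (f' := fun z => ((ContinuousLinearMap.toSpanSingleton ℂ (deriv f z)).restrictScalars ℝ))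
    (fun z hz => ((hf.differentiableAt (hU.mem_nhds hz)).hasDerivAt.hasFDerivAt.restrictScalars
      ℝ).hasFDerivWithinAt) hi]
  congr 1
  funext z
  congr 3
  simp [ContinuousLinearMap.det, LinearMap.det_restrictScalars, Algebra.norm_complex_eq,
    Complex.normSq_eq_norm_sq]

section inverse

variable {f : ℂ → ℂ}

theorem inverse_apply (hi : Set.InjOn f extDisc) {z : ℂ} (hz : z ∈ extDisc) :
    inverse f (f z) = z := hi.leftInvOn_invFunOn hz

theorem deriv_inverse_apply (hf : DifferentiableOn ℂ f extDisc) (hi : Set.InjOn f extDisc) {z : ℂ}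
    (hz : z ∈ extDisc) : deriv (inverse f) (f z) = (deriv f z)⁻¹ := by
  have hn := isOpen_extDisc.mem_nhds hz
  have h1 : HasStrictDerivAt f (deriv f z) z := (hf.analyticAt hn).hasStrictDerivAt
  refine (h1.to_local_left_inverse (deriv_ne_zero_of_injOn isOpen_extDisc hf hi hz)
    ?_).hasDerivAt.deriv
  filter_upwards [hn] with w hw using inverse_apply hi hw

end inverse

open Classical in
/-- The integrand of `F`, as a function on the plane. -/
noncomputable def inverseDensity (t β : ℝ) (f : ℂ → ℂ) (w : ℂ) : ℝ≥0∞ :=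
  if w ∈ f '' extDisc then
    ENNReal.ofReal (‖deriv (inverse f) w / inverse f w‖ ^ (2 - t) *
      Real.log ‖inverse f w‖ ^ (β - 1))
  else 0

theorem inverseDensity_apply (t β : ℝ) {f : ℂ → ℂ} (hf : DifferentiableOn ℂ f extDisc)
    (hi : Set.InjOn f extDisc) {z : ℂ} (hz : z ∈ extDisc) :
    inverseDensity t β f (f z) = ENNReal.ofReal
      ((‖deriv f z‖⁻¹ / ‖z‖) ^ (2 - t) * Real.log ‖z‖ ^ (β - 1)) := by
  rw [inverseDensity, if_pos ⟨z, hz, rfl⟩, inverse_apply hi hz, deriv_inverse_apply hf hi hz,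
    norm_div, norm_inv]

theorem inverseDensity_of_notMem (t β : ℝ) {f : ℂ → ℂ} {w : ℂ} (hw : w ∉ f '' extDisc) :
    inverseDensity t β f w = 0 := if_neg hw

/-! ### Joint continuity, equivariance and measurability. -/

namespace IsConformalFamily

variable {k : ℕ} {M : ℝ} {f : (ℕ → Torus) → ℂ → ℂ}

theorem one_le (H : IsConformalFamily k M f) : 1 ≤ M := by
  have h := (H.lower 0 2 two_mem_extDisc).trans (H.upper 0 2 two_mem_extDisc)
  rw [Complex.norm_ofNat] at h
  linarith

theorem deriv_ne_zero (H : IsConformalFamily k M f) (θ : ℕ → Torus) {z : ℂ} (hz : z ∈ extDisc) :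
    deriv (f θ) z ≠ 0 := deriv_ne_zero_of_injOn isOpen_extDisc (H.holo θ) (H.inj θ) hz

/-- Joint continuity makes θ ↦ f_θ continuous for locally uniform convergence, which passes to
derivatives of holomorphic functions. -/
theorem continuousOn_deriv (H : IsConformalFamily k M f) :
    ContinuousOn (fun p : (ℕ → Torus) × ℂ => deriv (f p.1) p.2) (Set.univ ×ˢ extDisc) := by
  rintro ⟨θ₀, z₀⟩ ⟨-, hz₀⟩
  have hz₀ : z₀ ∈ extDisc := hz₀
  have hloc : TendstoLocallyUniformlyOn f (f θ₀) (𝓝 θ₀) extDisc := by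
    rw [tendstoLocallyUniformlyOn_iff_forall_isCompact isOpen_extDisc]
    intro K hK hKc u hu
    obtain ⟨v, hv, hv'⟩ := hKc.mem_uniformity_of_prod (f := f) (s := Set.univ)
      (H.cont.mono (Set.prod_mono le_rfl hK)) (Set.mem_univ θ₀) (symm_le_uniformity hu)
    rw [nhdsWithin_univ] at hv
    filter_upwards [hv] with θ hθ z hz using hv' θ hθ z hz
  have hd := hloc.deriv (Eventually.of_forall H.holo) isOpen_extDisc
  have hc : ContinuousAt (deriv (f θ₀)) z₀ :=
    ((H.holo θ₀).deriv isOpen_extDisc).continuousOn.continuousAt (isOpen_extDisc.mem_nhds hz₀)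
  refine ContinuousAt.continuousWithinAt ?_
  have hs : Tendsto (fun p : (ℕ → Torus) × ℂ => p.2) (𝓝 (θ₀, z₀)) (𝓝[extDisc] z₀) := by
    rw [isOpen_extDisc.nhdsWithin_eq hz₀]
    exact continuous_snd.tendsto _
  refine tendsto_comp_of_locally_uniform_limit_within (F := fun p : (ℕ → Torus) × ℂ =>
    deriv (f p.1)) hc.continuousWithinAt hs fun u hu => ?_
  obtain ⟨t, ht, h⟩ := hd u hu z₀ hz₀
  exact ⟨t, ht, (continuous_fst.tendsto (θ₀, z₀)).eventually h⟩

theorem deriv_equivariant (H : IsConformalFamily k M f) (θ : ℕ → Torus) (α : Torus) {z : ℂ}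
    (hz : z ∈ extDisc) :
    deriv (f fun j => θ j + k ^ j • α) (expI α * z) = deriv (f θ) z := by
  have hz' := expI_mul_mem hz α
  have h1 : HasDerivAt (fun w => f (fun j => θ j + k ^ j • α) (expI α * w))
      (deriv (f fun j => θ j + k ^ j • α) (expI α * z) * expI α) z := by
    have h2 := ((H.holo fun j => θ j + k ^ j • α).differentiableAt
      (isOpen_extDisc.mem_nhds hz')).hasDerivAt
    have h3 : HasDerivAt (fun w => expI α * w) (expI α) z := by
      simpa using (hasDerivAt_id z).const_mul (expI α)
    exact h2.comp z h3
  have h4 : HasDerivAt (fun w => f (fun j => θ j + k ^ j • α) (expI α * w))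
      (expI α * deriv (f θ) z) z := by
    refine (((H.holo θ).differentiableAt
      (isOpen_extDisc.mem_nhds hz)).hasDerivAt.const_mul (expI α)).congr_of_eventuallyEq ?_
    filter_upwards [isOpen_extDisc.mem_nhds hz] with w hw using H.equivariant θ α w hw
  have := h1.unique h4
  rw [mul_comm] at this
  exact mul_left_cancel₀ (expI_ne_zero α) this

theorem image_equivariant (H : IsConformalFamily k M f) (θ : ℕ → Torus) (α : Torus) {w : ℂ} :
    expI α * w ∈ f (fun j => θ j + k ^ j • α) '' extDisc ↔ w ∈ f θ '' extDisc := by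
  constructor
  · rintro ⟨z, hz, h⟩
    have hz' := expI_mul_mem hz (-α)
    refine ⟨expI (-α) * z, hz', ?_⟩
    have h1 := H.equivariant θ α _ hz'
    have h2 : expI α * (expI (-α) * z) = z := by
      rw [expI_neg, mul_inv_cancel_left₀ (expI_ne_zero α)]
    rw [h2, h] at h1
    exact (mul_left_cancel₀ (expI_ne_zero α) h1).symm
  · rintro ⟨z, hz, rfl⟩
    exact ⟨_, expI_mul_mem hz α, H.equivariant θ α z hz⟩

theorem inverseDensity_equivariant (H : IsConformalFamily k M f) (t β : ℝ) (θ : ℕ → Torus)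
    (α : Torus) (w : ℂ) :
    inverseDensity t β (f fun j => θ j + k ^ j • α) (expI α * w) = inverseDensity t β (f θ) w := by
  by_cases hw : w ∈ f θ '' extDisc
  · obtain ⟨z, hz, rfl⟩ := hw
    rw [← H.equivariant θ α z hz, inverseDensity_apply t β (H.holo _) (H.inj _) (expI_mul_mem hz α),
      inverseDensity_apply t β (H.holo _) (H.inj _) hz, H.deriv_equivariant θ α hz, norm_mul,
      norm_expI, one_mul]
  · rw [inverseDensity_of_notMem t β hw,
      inverseDensity_of_notMem t β (mt (H.image_equivariant θ α).1 hw)]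

/-- The map (θ, z) ↦ (θ, f_θ(z)) is continuous and injective on a Polish space, hence a measurable
embedding. The density is a measurable function transported by it and extended by zero, so the
inverse, defined by choice, need not be studied directly. -/
theorem measurable_inverseDensity (H : IsConformalFamily k M f) (t β : ℝ) :
    Measurable fun p : (ℕ → Torus) × ℂ => inverseDensity t β (f p.1) p.2 := by
  let Ψ : (ℕ → Torus) × extDisc → (ℕ → Torus) × ℂ := fun p => (p.1, f p.1 p.2)
  have : PolishSpace extDisc := isOpen_extDisc.polishSpace
  have hincl : Continuous fun p : (ℕ → Torus) × extDisc => (p.1, (p.2 : ℂ)) := by fun_prop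
  have hΨc : Continuous Ψ := continuous_fst.prodMk
    (H.cont.comp_continuous hincl fun p => ⟨Set.mem_univ _, p.2.2⟩)
  have hΨi : Function.Injective Ψ := by
    rintro ⟨θ, z⟩ ⟨θ', z'⟩ h
    simp only [Ψ, Prod.mk.injEq] at h
    obtain ⟨rfl, h⟩ := h
    rw [Subtype.ext (H.inj θ z.2 z'.2 h)]
  have hΨ : MeasurableEmbedding Ψ := hΨc.measurableEmbedding hΨi
  let g : (ℕ → Torus) × extDisc → ℝ≥0∞ := fun p => ENNReal.ofReal
    ((‖deriv (f p.1) p.2‖⁻¹ / ‖(p.2 : ℂ)‖) ^ (2 - t) * Real.log ‖(p.2 : ℂ)‖ ^ (β - 1))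
  have hd : Measurable fun p : (ℕ → Torus) × extDisc => deriv (f p.1) p.2 :=
    (H.continuousOn_deriv.comp_continuous hincl fun p => ⟨Set.mem_univ _, p.2.2⟩).measurable
  have hg : Measurable g := by fun_prop
  have heq : (fun p : (ℕ → Torus) × ℂ => inverseDensity t β (f p.1) p.2) =
      Function.extend Ψ g fun _ => 0 := by
    funext ⟨θ, w⟩
    by_cases hw : w ∈ f θ '' extDisc
    · obtain ⟨z, hz, rfl⟩ := hw
      have : (θ, f θ z) = Ψ (θ, ⟨z, hz⟩) := rfl
      rw [this, hΨi.extend_apply]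
      exact inverseDensity_apply t β (H.holo _) (H.inj _) hz
    · rw [Function.extend_apply', inverseDensity_of_notMem t β hw]
      rintro ⟨⟨θ', z⟩, h⟩
      simp only [Ψ, Prod.mk.injEq] at h
      obtain ⟨rfl, h⟩ := h
      exact hw ⟨z, z.2, h⟩
  rw [heq]
  exact hΨ.measurable_extend hg measurable_const

/-- A measurable function of `‖f'(z)‖` and `‖z‖`, extended by zero, is jointly measurable. -/
theorem measurable_indicator_deriv (H : IsConformalFamily k M f) {u : ℝ → ℝ → ℝ≥0∞}
    (hu : Measurable fun p : ℝ × ℝ => u p.1 p.2) :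
    Measurable ((Set.univ ×ˢ extDisc).indicator
      fun p : (ℕ → Torus) × ℂ => u ‖deriv (f p.1) p.2‖ ‖p.2‖) := by
  have hm : MeasurableSet (Set.univ ×ˢ extDisc : Set ((ℕ → Torus) × ℂ)) :=
    MeasurableSet.univ.prod isOpen_extDisc.measurableSet
  refine measurable_of_restrict_of_restrict_compl hm ?_ ?_
  · have hd : Measurable fun p : (Set.univ ×ˢ extDisc : Set ((ℕ → Torus) × ℂ)) =>
        deriv (f p.1.1) p.1.2 :=
      (continuousOn_iff_continuous_domRestrict.1 H.continuousOn_deriv).measurable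
    have h := hu.comp (hd.norm.prodMk (g := fun p => ‖p.1.2‖) (by fun_prop))
    convert h using 1
    funext p
    exact Set.indicator_of_mem p.2 _
  · convert measurable_const (a := (0 : ℝ≥0∞)) using 1
    funext p
    exact Set.indicator_of_notMem p.2 _

end IsConformalFamily

/-! ### Comparison of weights and cuts of the real line. -/

theorem ofReal_two_pi_mul_lt_top_iff {a : ℝ≥0∞} : ENNReal.ofReal (2 * π) * a < ∞ ↔ a < ∞ := by
  have h0 : ENNReal.ofReal (2 * π) ≠ 0 := (ENNReal.ofReal_pos.2 Real.two_pi_pos).ne'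
  simp only [lt_top_iff_ne_top, ne_eq, ENNReal.mul_eq_top, h0, ENNReal.ofReal_ne_top, false_and,
    not_false_eq_true, true_and, or_false]

theorem setLIntegral_Ioo_ofReal_mul_lt_top_iff (h : ℝ → ℝ≥0∞) (R : ℝ) :
    ∫⁻ r in Set.Ioo 1 R, ENNReal.ofReal r * h r < ∞ ↔ ∫⁻ r in Set.Ioo 1 R, h r < ∞ := by
  constructor
  · refine fun hlt => lt_of_le_of_lt (setLIntegral_mono' measurableSet_Ioo fun r hr => ?_) hlt
    exact le_mul_of_one_le_left' (ENNReal.one_le_ofReal.2 hr.1.le)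
  · intro hlt
    have h1 : ∫⁻ r in Set.Ioo 1 R, ENNReal.ofReal r * h r ≤
        ∫⁻ r in Set.Ioo 1 R, ENNReal.ofReal R * h r :=
      setLIntegral_mono' measurableSet_Ioo fun r hr => by gcongr; exact hr.2.le
    rw [lintegral_const_mul' _ _ ENNReal.ofReal_ne_top] at h1
    exact h1.trans_lt (ENNReal.mul_lt_top ENNReal.ofReal_lt_top hlt)

theorem rpow_le_rpow_abs_mul_rpow {l y R : ℝ} (a : ℝ) (hl : 0 < l) (hy : 0 < y) (hR : 1 ≤ R)
    (h1 : l ≤ R * y) (h2 : y ≤ R * l) : l ^ a ≤ R ^ |a| * y ^ a := by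
  have hR0 : 0 < R := by linarith
  rcases le_total 0 a with ha | ha
  · rw [abs_of_nonneg ha, ← Real.mul_rpow hR0.le hy.le]
    exact Real.rpow_le_rpow hl.le h1 ha
  · rw [abs_of_nonpos ha, Real.rpow_neg hR0.le, ← Real.inv_rpow hR0.le,
      ← Real.mul_rpow (by positivity) hy.le]
    refine Real.rpow_le_rpow_of_nonpos (by positivity) ?_ ha
    rw [inv_mul_le_iff₀ hR0]
    exact h2

/-- Comparison of the weights in the two integrals. -/
theorem exists_weight_comparison (t β : ℝ) {R : ℝ} (hR : 1 ≤ R) :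
    ∃ c : ℝ, ∀ x, 1 < x → x < R →
      ENNReal.ofReal (x ^ (t - 2) * Real.log x ^ (β - 1)) ≤
        ENNReal.ofReal c * ENNReal.ofReal ((x - 1) ^ (β - 1)) ∧
      ENNReal.ofReal ((x - 1) ^ (β - 1)) ≤
        ENNReal.ofReal c * ENNReal.ofReal (x ^ (t - 2) * Real.log x ^ (β - 1)) := by
  have hR0 : 0 < R := by linarith
  refine ⟨R ^ |t - 2| * R ^ |β - 1|, fun x hx hxR => ?_⟩
  have hx0 : 0 < x := by linarith
  have hl : 0 < Real.log x := Real.log_pos hx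
  have hy : 0 < x - 1 := by linarith
  have h1 : Real.log x ≤ x - 1 := Real.log_le_sub_one_of_pos hx0
  -- Uses 1 - 1/x ≤ log x, multiplied by x < R.
  have h2 : x - 1 ≤ R * Real.log x := by
    have h3 : 1 - x⁻¹ ≤ Real.log x := Real.one_sub_inv_le_log_of_pos hx0
    have h4 : x * (1 - x⁻¹) = x - 1 := by field_simp
    calc x - 1 = x * (1 - x⁻¹) := h4.symm
      _ ≤ x * Real.log x := by gcongr
      _ ≤ _ := by gcongr
  have h1' : Real.log x ≤ R * (x - 1) := h1.trans (le_mul_of_one_le_left hy.le hR)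
  have h2' : x - 1 ≤ R * Real.log x := h2
  have a1 := rpow_le_rpow_abs_mul_rpow (β - 1) hl hy hR h1' h2'
  have a2 := rpow_le_rpow_abs_mul_rpow (β - 1) hy hl hR h2' h1'
  have hxle : x ≤ R * 1 := by linarith
  have hxle' : 1 ≤ R * x := by nlinarith
  have b1 := rpow_le_rpow_abs_mul_rpow (t - 2) hx0 one_pos hR hxle hxle'
  have b2 := rpow_le_rpow_abs_mul_rpow (t - 2) one_pos hx0 hR hxle' hxle
  rw [Real.one_rpow] at b1 b2
  rw [mul_one] at b1
  have hc : 0 ≤ R ^ |t - 2| * R ^ |β - 1| := by positivity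
  rw [← ENNReal.ofReal_mul hc, ← ENNReal.ofReal_mul hc]
  constructor
  · refine ENNReal.ofReal_le_ofReal ?_
    calc x ^ (t - 2) * Real.log x ^ (β - 1)
        ≤ R ^ |t - 2| * (R ^ |β - 1| * (x - 1) ^ (β - 1)) := by gcongr
      _ = _ := by ring
  · refine ENNReal.ofReal_le_ofReal ?_
    calc (x - 1) ^ (β - 1) = 1 * (x - 1) ^ (β - 1) := (one_mul _).symm
      _ ≤ (R ^ |t - 2| * x ^ (t - 2)) * (R ^ |β - 1| * Real.log x ^ (β - 1)) := by gcongr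
      _ = _ := by ring

/-- A real strictly between the supremum and the infimum would lie in neither set. Working in
`EReal` also covers an empty S or T. -/
theorem sSup_coe_image_eq_sInf_coe_image {S T : Set ℝ} (hST : ∀ β, β ∈ S ∨ β ∈ T)
    (hlt : ∀ β ∈ S, ∀ γ ∈ T, β ≤ γ) :
    sSup ((fun β : ℝ => (β : EReal)) '' S) = sInf ((fun β : ℝ => (β : EReal)) '' T) := by
  refine le_antisymm (sSup_le ?_) ?_
  · rintro _ ⟨β, hβ, rfl⟩
    refine le_sInf ?_
    rintro _ ⟨γ, hγ, rfl⟩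
    exact EReal.coe_le_coe_iff.2 (hlt β hβ γ hγ)
  · by_contra h
    push Not at h
    obtain ⟨x, hx1, hx2⟩ := EReal.lt_iff_exists_real_btwn.1 h
    rcases hST x with hx | hx
    · exact absurd (le_sSup (Set.mem_image_of_mem _ hx)) (not_le.2 hx1)
    · exact absurd (sInf_le (Set.mem_image_of_mem _ hx)) (not_le.2 hx2)

/-! ### Radial, planar and inverse integrals. -/

/-- The mean of `|f'(r)|^t` over the angles. -/
noncomputable def derivMean (f : (ℕ → Torus) → ℂ → ℂ) (t r : ℝ) : ℝ≥0∞ :=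
  ∫⁻ θ, ENNReal.ofReal (‖deriv (f θ) (r : ℂ)‖ ^ t) ∂angleLaw

/-- `∫_1^R (r-1)^{β-1} 𝔼|f'(r)|^t dr`. -/
noncomputable def radialIntegral (f : (ℕ → Torus) → ℂ → ℂ) (t β R : ℝ) : ℝ≥0∞ :=
  ∫⁻ r in Set.Ioo 1 R, ENNReal.ofReal ((r - 1) ^ (β - 1)) * derivMean f t r

/-- The mean over the angles of the integral of `v(|z|) |f'(z)|^t` over the exterior disc. -/
noncomputable def areaIntegral (f : (ℕ → Torus) → ℂ → ℂ) (t : ℝ) (v : ℝ → ℝ≥0∞) : ℝ≥0∞ :=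
  ∫⁻ θ, (∫⁻ z in extDisc, v ‖z‖ * ENNReal.ofReal (‖deriv (f θ) z‖ ^ t)) ∂angleLaw

/-- The mean of the integrand of `F` over the angles. -/
noncomputable def inverseMean (f : (ℕ → Torus) → ℂ → ℂ) (t β r : ℝ) : ℝ≥0∞ :=
  ∫⁻ θ, inverseDensity t β (f θ) (r : ℂ) ∂angleLaw

theorem norm_ofReal_of_one_lt {r : ℝ} (hr : 1 < r) : ‖(r : ℂ)‖ = r := by
  rw [Complex.norm_real, Real.norm_of_nonneg (by linarith)]

theorem ofReal_mem_extDisc {r : ℝ} (hr : 1 < r) : (r : ℂ) ∈ extDisc := by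
  change 1 < ‖(r : ℂ)‖
  rwa [norm_ofReal_of_one_lt hr]

namespace IsConformalFamily

variable {k : ℕ} {M : ℝ} {f : (ℕ → Torus) → ℂ → ℂ}

theorem measurable_deriv_apply (H : IsConformalFamily k M f) {z : ℂ} (hz : z ∈ extDisc) :
    Measurable fun θ => deriv (f θ) z :=
  (H.continuousOn_deriv.comp_continuous (f := fun θ : ℕ → Torus => (θ, z)) (by fun_prop)
    fun _ => ⟨Set.mem_univ _, hz⟩).measurable

theorem lintegral_deriv_expI_mul (H : IsConformalFamily k M f) (t : ℝ) (α : Torus) {z : ℂ}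
    (hz : z ∈ extDisc) :
    ∫⁻ θ, ENNReal.ofReal (‖deriv (f θ) (expI α * z)‖ ^ t) ∂angleLaw =
      ∫⁻ θ, ENNReal.ofReal (‖deriv (f θ) z‖ ^ t) ∂angleLaw := by
  have hm : Measurable fun θ => ENNReal.ofReal (‖deriv (f θ) (expI α * z)‖ ^ t) := by
    have := H.measurable_deriv_apply (expI_mul_mem hz α)
    fun_prop
  rw [← (measurePreserving_add_angleLaw fun j => k ^ j • α).lintegral_comp hm]
  exact lintegral_congr fun θ => by rw [H.deriv_equivariant θ α hz]

theorem meansIntegral_eq (H : IsConformalFamily k M f) {Ω : Type*} [MeasurableSpace Ω]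
    {P : Measure Ω} {Θ : Ω → ℕ → Torus} (hΘ : AEMeasurable Θ P) (hmap : P.map Θ = angleLaw)
    (t β R : ℝ) :
    meansIntegral P (fun ω => f (Θ ω)) t β R = ENNReal.ofReal (2 * π) * radialIntegral f t β R := by
  rw [meansIntegral, radialIntegral, ← lintegral_const_mul' _ _ ENNReal.ofReal_ne_top]
  refine setLIntegral_congr_fun measurableSet_Ioo fun r hr => ?_
  have hr1 := ofReal_mem_extDisc hr.1
  have hin : ∀ s : ℝ, ∫⁻ ω, ENNReal.ofReal
      (‖deriv (f (Θ ω)) (r * Complex.exp (s * Complex.I))‖ ^ t) ∂P = derivMean f t r := by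
    intro s
    have hz : (r : ℂ) * Complex.exp (s * Complex.I) = expI (s : Torus) * r := by
      rw [expI_coe, mul_comm]
    rw [hz, derivMean, ← H.lintegral_deriv_expI_mul t s hr1, ← hmap,
      lintegral_map' (f := fun θ => ENNReal.ofReal (‖deriv (f θ) (expI s * r)‖ ^ t)) ?_ hΘ]
    have := H.measurable_deriv_apply (expI_mul_mem hr1 (s : Torus))
    have h2 : Measurable fun θ => ENNReal.ofReal (‖deriv (f θ) (expI s * r)‖ ^ t) := by fun_prop
    exact h2.aemeasurable
  simp only [hin, lintegral_const, Measure.restrict_apply MeasurableSet.univ, Set.univ_inter,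
    Real.volume_Ioc, sub_zero]
  ring

theorem F_eq (H : IsConformalFamily k M f) {Ω : Type*} [MeasurableSpace Ω]
    {P : Measure Ω} {Θ : Ω → ℕ → Torus} (hΘ : AEMeasurable Θ P) (hmap : P.map Θ = angleLaw)
    (t β r : ℝ) : F P (fun ω => f (Θ ω)) t β r = inverseMean f t β r := by
  rw [inverseMean, ← hmap, lintegral_map' (f := fun θ => inverseDensity t β (f θ) (r : ℂ)) ?_ hΘ]
  · rfl
  · exact ((H.measurable_inverseDensity t β).comp measurable_prodMk_right).aemeasurable

theorem measurable_inverseMean (H : IsConformalFamily k M f) (t β : ℝ) :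
    Measurable (inverseMean f t β) :=
  (H.measurable_inverseDensity t β).lintegral_prod_left'.comp Complex.measurable_ofReal

theorem areaIntegral_eq (H : IsConformalFamily k M f) (t β R : ℝ) :
    areaIntegral f t ((Set.Ioo 1 R).indicator fun x => ENNReal.ofReal ((x - 1) ^ (β - 1))) =
      ENNReal.ofReal (2 * π) * ∫⁻ r in Set.Ioo 1 R,
        ENNReal.ofReal r * (ENNReal.ofReal ((r - 1) ^ (β - 1)) * derivMean f t r) := by
  set v : ℝ → ℝ≥0∞ := (Set.Ioo 1 R).indicator fun x => ENNReal.ofReal ((x - 1) ^ (β - 1)) with hv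
  have hvm : Measurable v := Measurable.indicator (by fun_prop) measurableSet_Ioo
  set J : (ℕ → Torus) × ℂ → ℝ≥0∞ := (Set.univ ×ˢ extDisc).indicator
    fun p => v ‖p.2‖ * ENNReal.ofReal (‖deriv (f p.1) p.2‖ ^ t) with hJdef
  have hJ : Measurable J := H.measurable_indicator_deriv
    (u := fun a b => v b * ENNReal.ofReal (a ^ t)) (by fun_prop)
  have hJin : ∀ θ, ∀ z ∈ extDisc, J (θ, z) = v ‖z‖ * ENNReal.ofReal (‖deriv (f θ) z‖ ^ t) :=
    fun θ z hz => Set.indicator_of_mem (by exact ⟨Set.mem_univ _, hz⟩) _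
  have hJout : ∀ θ, ∀ z ∉ extDisc, J (θ, z) = 0 :=
    fun θ z hz => Set.indicator_of_notMem (fun h => hz h.2) _
  have hinv : ∀ θ α z, J ((fun j => θ j + k ^ j • α), expI α * z) = J (θ, z) := by
    intro θ α z
    by_cases hz : z ∈ extDisc
    · rw [hJin _ _ hz, hJin _ _ (expI_mul_mem hz α), H.deriv_equivariant θ α hz, norm_mul,
        norm_expI, one_mul]
    · rw [hJout _ _ hz, hJout]
      intro h
      refine hz ?_
      have h' : 1 < ‖expI α * z‖ := h
      rwa [norm_mul, norm_expI, one_mul] at h'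
  have hmain := lintegral_lintegral_eq_of_equivariant hJ hinv
  have h1 : areaIntegral f t v = ∫⁻ θ, (∫⁻ z, J (θ, z)) ∂angleLaw := by
    refine lintegral_congr fun θ => ?_
    rw [← lintegral_indicator isOpen_extDisc.measurableSet]
    refine lintegral_congr fun z => ?_
    by_cases hz : z ∈ extDisc
    · rw [hJin _ _ hz, Set.indicator_of_mem hz]
    · rw [hJout _ _ hz, Set.indicator_of_notMem hz]
  rw [h1, hmain]
  congr 1
  rw [← lintegral_indicator measurableSet_Ioi, ← lintegral_indicator measurableSet_Ioo]
  refine lintegral_congr fun r => ?_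
  by_cases hr : r ∈ Set.Ioo 1 R
  · have hr0 : r ∈ Set.Ioi (0 : ℝ) := zero_lt_one.trans hr.1
    rw [Set.indicator_of_mem hr, Set.indicator_of_mem hr0]
    have hz := ofReal_mem_extDisc hr.1
    congr 1
    have : ∀ θ, J (θ, (r : ℂ)) = ENNReal.ofReal ((r - 1) ^ (β - 1)) *
        ENNReal.ofReal (‖deriv (f θ) (r : ℂ)‖ ^ t) := fun θ => by
      rw [hJin θ _ hz, norm_ofReal_of_one_lt hr.1, hv, Set.indicator_of_mem hr]
    simp only [this]
    rw [lintegral_const_mul' _ _ ENNReal.ofReal_ne_top]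
    rfl
  · rw [Set.indicator_of_notMem hr]
    by_cases hr0 : r ∈ Set.Ioi (0 : ℝ)
    · rw [Set.indicator_of_mem hr0]
      have : ∀ θ, J (θ, (r : ℂ)) = 0 := fun θ => by
        by_cases hz : (r : ℂ) ∈ extDisc
        · have hr1 : 1 < ‖(r : ℂ)‖ := hz
          rw [Complex.norm_real, Real.norm_of_nonneg (le_of_lt hr0)] at hr1
          rw [hJin θ _ hz, norm_ofReal_of_one_lt hr1, hv, Set.indicator_of_notMem hr, zero_mul]
        · exact hJout θ _ hz
      simp [this]
    · rw [Set.indicator_of_notMem hr0]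

/-- Polar coordinates in the image plane, then the substitution w = f(z): the Jacobian |f'|^2 times
(|f'| |z|)^{t-2} leaves |f'|^t |z|^{t-2}. -/
theorem lintegral_inverseMean_eq (H : IsConformalFamily k M f) (t β R : ℝ) :
    ENNReal.ofReal (2 * π) *
        ∫⁻ r in Set.Ioo 1 R, ENNReal.ofReal r * inverseMean f t β r =
      ∫⁻ θ, (∫⁻ z in extDisc, {z | ‖f θ z‖ < R}.indicator (fun z =>
        ENNReal.ofReal (‖z‖ ^ (t - 2) * Real.log ‖z‖ ^ (β - 1)) *
          ENNReal.ofReal (‖deriv (f θ) z‖ ^ t)) z) ∂angleLaw := by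
  have hball : MeasurableSet {p : (ℕ → Torus) × ℂ | ‖p.2‖ < R} :=
    measurableSet_lt (by fun_prop) measurable_const
  set J : (ℕ → Torus) × ℂ → ℝ≥0∞ := {p | ‖p.2‖ < R}.indicator
    fun p => inverseDensity t β (f p.1) p.2 with hJdef
  have hJ : Measurable J := (H.measurable_inverseDensity t β).indicator hball
  have hJin : ∀ θ z, ‖z‖ < R → J (θ, z) = inverseDensity t β (f θ) z :=
    fun θ z hz => Set.indicator_of_mem (by exact hz) _
  have hJout : ∀ θ z, ¬ ‖z‖ < R → J (θ, z) = 0 :=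
    fun θ z hz => Set.indicator_of_notMem (by exact hz) _
  have hinv : ∀ θ α z, J ((fun j => θ j + k ^ j • α), expI α * z) = J (θ, z) := by
    intro θ α z
    have hn : ‖expI α * z‖ = ‖z‖ := by rw [norm_mul, norm_expI, one_mul]
    by_cases hz : ‖z‖ < R
    · rw [hJin _ _ hz, hJin _ _ (by rwa [hn]), H.inverseDensity_equivariant]
    · rw [hJout _ _ hz, hJout _ _ (by rwa [hn])]
  have hzero : ∀ θ, ∀ w ∉ f θ '' extDisc, J (θ, w) = 0 := by
    intro θ w hw
    by_cases hz : ‖w‖ < R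
    · rw [hJin _ _ hz, inverseDensity_of_notMem t β hw]
    · exact hJout _ _ hz
  have hmain := lintegral_lintegral_eq_of_equivariant hJ hinv
  have h1 : ∫⁻ r in Set.Ioi (0 : ℝ), ENNReal.ofReal r * ∫⁻ θ, J (θ, (r : ℂ)) ∂angleLaw =
      ∫⁻ r in Set.Ioo 1 R, ENNReal.ofReal r * inverseMean f t β r := by
    rw [← lintegral_indicator measurableSet_Ioi, ← lintegral_indicator measurableSet_Ioo]
    refine lintegral_congr fun r => ?_
    by_cases hr0 : r ∈ Set.Ioi (0 : ℝ)
    · rw [Set.indicator_of_mem hr0]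
      have hnr : ‖(r : ℂ)‖ = r := by rw [Complex.norm_real, Real.norm_of_nonneg (le_of_lt hr0)]
      by_cases hr : r ∈ Set.Ioo 1 R
      · rw [Set.indicator_of_mem hr]
        congr 1
        exact lintegral_congr fun θ => hJin θ _ (by rw [hnr]; exact hr.2)
      · rw [Set.indicator_of_notMem hr]
        -- Radii r ≤ 1 contribute nothing, because |f(z)| ≥ |z| > 1 keeps them out of the image.
        have : ∀ θ, J (θ, (r : ℂ)) = 0 := fun θ => by
          by_cases h2 : r < R
          · refine hzero θ _ ?_
            rintro ⟨z, hz, hzr⟩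
            have h3 : 1 < ‖z‖ := hz
            have h4 := H.lower θ z hz
            rw [hzr, hnr] at h4
            exact hr ⟨h3.trans_le h4, h2⟩
          · exact hJout θ _ (by rwa [hnr])
        simp [this]
    · rw [Set.indicator_of_notMem hr0, Set.indicator_of_notMem]
      exact fun h => hr0 (zero_lt_one.trans h.1)
  rw [← h1, ← hmain]
  refine lintegral_congr fun θ => ?_
  have himg : MeasurableSet (f θ '' extDisc) :=
    isOpen_extDisc.measurableSet.image_of_continuousOn_injOn (H.holo θ).continuousOn (H.inj θ)
  have h2 : ∫⁻ w, J (θ, w) = ∫⁻ w in f θ '' extDisc, J (θ, w) := by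
    rw [← lintegral_indicator himg]
    refine lintegral_congr fun w => ?_
    by_cases hw : w ∈ f θ '' extDisc
    · rw [Set.indicator_of_mem hw]
    · rw [Set.indicator_of_notMem hw, hzero θ w hw]
  rw [h2, lintegral_image_eq_lintegral_norm_deriv_sq_mul isOpen_extDisc (H.holo θ) (H.inj θ)]
  refine setLIntegral_congr_fun isOpen_extDisc.measurableSet fun z hz => ?_
  by_cases hR : ‖f θ z‖ < R
  · rw [hJin _ _ hR, Set.indicator_of_mem (by exact hR), inverseDensity_apply t β (H.holo θ)
      (H.inj θ) hz, ← ENNReal.ofReal_mul (by positivity), mul_comm (ENNReal.ofReal (_ * _)),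
      ← ENNReal.ofReal_mul (by positivity)]
    congr 1
    have hz0 : 0 < ‖z‖ := zero_lt_one.trans hz
    have hd : 0 < ‖deriv (f θ) z‖ := norm_pos_iff.2 (H.deriv_ne_zero θ hz)
    have e1 : (‖deriv (f θ) z‖⁻¹ / ‖z‖) ^ (2 - t) =
        ‖deriv (f θ) z‖ ^ (t - 2) * ‖z‖ ^ (t - 2) := by
      rw [div_eq_mul_inv, ← mul_inv, Real.inv_rpow (by positivity), ← Real.rpow_neg (by positivity),
        neg_sub, Real.mul_rpow hd.le hz0.le]
    have e2 : ‖deriv (f θ) z‖ ^ 2 * ‖deriv (f θ) z‖ ^ (t - 2) = ‖deriv (f θ) z‖ ^ t := by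
      rw [← Real.rpow_natCast, ← Real.rpow_add hd]
      congr 1
      push_cast; ring
    rw [e1, ← e2]
    ring
  · rw [hJout _ _ hR, Set.indicator_of_notMem (by exact hR), mul_zero]

theorem areaIntegral_lt_top_iff (H : IsConformalFamily k M f) (t β R : ℝ) :
    areaIntegral f t ((Set.Ioo 1 R).indicator fun x => ENNReal.ofReal ((x - 1) ^ (β - 1))) < ∞ ↔
      radialIntegral f t β R < ∞ := by
  rw [H.areaIntegral_eq, ofReal_two_pi_mul_lt_top_iff, setLIntegral_Ioo_ofReal_mul_lt_top_iff]
  rfl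

theorem inverseMean_lt_top_of_radialIntegral (H : IsConformalFamily k M f) (t β : ℝ) {R : ℝ}
    (hR : 1 < R) (h : radialIntegral f t β R < ∞) :
    ∫⁻ r in Set.Ioo 1 R, inverseMean f t β r < ∞ := by
  rw [← setLIntegral_Ioo_ofReal_mul_lt_top_iff, ← ofReal_two_pi_mul_lt_top_iff,
    H.lintegral_inverseMean_eq]
  rw [← H.areaIntegral_lt_top_iff] at h
  obtain ⟨c, hc⟩ := exists_weight_comparison t β hR.le
  refine lt_of_le_of_lt ?_ (ENNReal.mul_lt_top (a := ENNReal.ofReal c) ENNReal.ofReal_lt_top h)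
  rw [areaIntegral, ← lintegral_const_mul' _ _ ENNReal.ofReal_ne_top]
  refine lintegral_mono fun θ => ?_
  rw [← lintegral_const_mul' _ _ ENNReal.ofReal_ne_top]
  refine setLIntegral_mono' isOpen_extDisc.measurableSet fun z hz => ?_
  by_cases hz' : ‖f θ z‖ < R
  · have hzR : ‖z‖ < R := (H.lower θ z hz).trans_lt hz'
    rw [Set.indicator_of_mem (by exact hz'), Set.indicator_of_mem (by exact ⟨hz, hzR⟩), ← mul_assoc]
    gcongr
    exact (hc _ hz hzR).1
  · rw [Set.indicator_of_notMem (by exact hz')]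
    exact zero_le

/-- Here |z| < R only gives |f(z)| < R M, hence the larger radius in the hypothesis; in the converse
direction |f(z)| < R already forces |z| < R. -/
theorem radialIntegral_lt_top_of_inverseMean (H : IsConformalFamily k M f) (t β : ℝ) {R : ℝ}
    (hR : 1 < R) (h : ∫⁻ r in Set.Ioo 1 (R * M), inverseMean f t β r < ∞) :
    radialIntegral f t β R < ∞ := by
  rw [← setLIntegral_Ioo_ofReal_mul_lt_top_iff, ← ofReal_two_pi_mul_lt_top_iff,
    H.lintegral_inverseMean_eq] at h
  rw [← H.areaIntegral_lt_top_iff]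
  obtain ⟨c, hc⟩ := exists_weight_comparison t β hR.le
  refine lt_of_le_of_lt ?_ (ENNReal.mul_lt_top (a := ENNReal.ofReal c) ENNReal.ofReal_lt_top h)
  rw [areaIntegral, ← lintegral_const_mul' _ _ ENNReal.ofReal_ne_top]
  refine lintegral_mono fun θ => ?_
  rw [← lintegral_const_mul' _ _ ENNReal.ofReal_ne_top]
  refine setLIntegral_mono' isOpen_extDisc.measurableSet fun z hz => ?_
  by_cases hzR : ‖z‖ < R
  · have hz' : ‖f θ z‖ < R * M := (H.upper θ z hz).trans_lt
      (mul_lt_mul_of_pos_right hzR (zero_lt_one.trans_le H.one_le))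
    rw [Set.indicator_of_mem (by exact ⟨hz, hzR⟩), Set.indicator_of_mem (by exact hz'), ← mul_assoc]
    gcongr
    exact (hc _ hz hzR).2
  · rw [Set.indicator_of_notMem (fun h => hzR h.2), zero_mul]
    exact zero_le

/-- The space of angles is compact and f' is jointly continuous without zeros, so |f'|^t is bounded
on compact sets even for negative t. -/
theorem exists_derivMean_le (H : IsConformalFamily k M f) (t : ℝ) {R₀ : ℝ} (hR₀ : 1 < R₀) (R : ℝ) :
    ∃ B : ℝ, ∀ r ∈ Set.Icc R₀ R, derivMean f t r ≤ ENNReal.ofReal B := by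
  have hK : IsCompact ((Set.univ : Set (ℕ → Torus)) ×ˢ (Complex.ofReal '' Set.Icc R₀ R)) :=
    isCompact_univ.prod (isCompact_Icc.image Complex.continuous_ofReal)
  have hsub : (Set.univ : Set (ℕ → Torus)) ×ˢ (Complex.ofReal '' Set.Icc R₀ R) ⊆
      Set.univ ×ˢ extDisc := by
    refine Set.prod_mono le_rfl ?_
    rintro _ ⟨r, hr, rfl⟩
    exact ofReal_mem_extDisc (hR₀.trans_le hr.1)
  have hc : ContinuousOn (fun p : (ℕ → Torus) × ℂ => ‖deriv (f p.1) p.2‖ ^ t)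
      (Set.univ ×ˢ (Complex.ofReal '' Set.Icc R₀ R)) :=
    (H.continuousOn_deriv.mono hsub).norm.rpow_const fun p hp =>
      Or.inl (norm_ne_zero_iff.2 (H.deriv_ne_zero p.1 (hsub hp).2))
  obtain ⟨B, hB⟩ := hK.exists_bound_of_continuousOn hc
  refine ⟨B, fun r hr => ?_⟩
  calc derivMean f t r ≤ ∫⁻ _, ENNReal.ofReal B ∂angleLaw := by
        refine lintegral_mono fun θ => ENNReal.ofReal_le_ofReal ?_
        exact (Real.le_norm_self _).trans (hB (θ, (r : ℂ)) ⟨Set.mem_univ _, r, hr, rfl⟩)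
    _ = ENNReal.ofReal B := by simp

/-- Only the behaviour at r = 1 matters: away from it the weight and the mean are bounded. -/
theorem radialIntegral_lt_top (H : IsConformalFamily k M f) {t β R₀ : ℝ} (hR₀ : 1 < R₀)
    (h : radialIntegral f t β R₀ < ∞) (R : ℝ) : radialIntegral f t β R < ∞ := by
  obtain ⟨B, hB⟩ := H.exists_derivMean_le t hR₀ R
  have hc : ContinuousOn (fun r : ℝ => (r - 1) ^ (β - 1)) (Set.Icc R₀ R) :=
    (continuousOn_id.sub continuousOn_const).rpow_const fun r hr =>
      Or.inl (sub_pos.2 (hR₀.trans_le hr.1)).ne'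
  obtain ⟨A, hA⟩ := isCompact_Icc.exists_bound_of_continuousOn hc
  have hsub : Set.Ioo 1 R ⊆ Set.Ioo 1 R₀ ∪ Set.Icc R₀ R := by
    intro r hr
    rcases lt_or_ge r R₀ with h1 | h1
    · exact Or.inl ⟨hr.1, h1⟩
    · exact Or.inr ⟨h1, hr.2.le⟩
  refine (lintegral_mono_set hsub).trans_lt ((lintegral_union_le _ _ _).trans_lt
    (ENNReal.add_lt_top.2 ⟨h, ?_⟩))
  calc _ ≤ ∫⁻ _ in Set.Icc R₀ R, ENNReal.ofReal A * ENNReal.ofReal B := by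
        refine setLIntegral_mono' measurableSet_Icc fun r hr => ?_
        gcongr
        · exact (Real.le_norm_self _).trans (hA r hr)
        · exact hB r hr
    _ < ∞ := by
        rw [setLIntegral_const, Real.volume_Icc]
        exact ENNReal.mul_lt_top (ENNReal.mul_lt_top ENNReal.ofReal_lt_top ENNReal.ofReal_lt_top)
          ENNReal.ofReal_lt_top

theorem radialIntegral_lt_top_of_le (H : IsConformalFamily k M f) {t β β' : ℝ} (hβ : β ≤ β')
    {R : ℝ} (hR : 1 < R) (h : radialIntegral f t β R < ∞) : radialIntegral f t β' R < ∞ := by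
  -- Passing to radius 2 gives r - 1 ≤ 1, where raising the exponent decreases the weight.
  refine H.radialIntegral_lt_top one_lt_two (lt_of_le_of_lt ?_ (H.radialIntegral_lt_top hR h 2)) R
  refine setLIntegral_mono' measurableSet_Ioo fun r hr => ?_
  refine mul_le_mul' (ENNReal.ofReal_le_ofReal ?_) le_rfl
  exact Real.rpow_le_rpow_of_exponent_ge (sub_pos.2 hr.1) (by linarith [hr.2]) (by linarith)

end IsConformalFamily

end Snowflake

/-! ### The sup of divergent exponents equals the inf of integrable ones. -/

theorem mainTheorem4 {Ω : Type*} [MeasurableSpace Ω] (P : Measure Ω) [IsProbabilityMeasure P]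
    (φ : ℂ → ℂ) (hφ : Snowflake.IsSigma' φ) (k : ℕ) (hk : 2 ≤ k)
    (θ : ℕ → Ω → Snowflake.Torus) (hindep : iIndepFun θ P)
    (hunif : ∀ n, HasLaw (θ n) AddCircle.haarAddCircle P) (t : ℝ) :
    Snowflake.avgSpectrum P (fun ω => Snowflake.snowflake φ k (fun n => θ n ω)) t =
      sInf ((fun β : ℝ => (β : EReal)) ''
        {β | Snowflake.ClassL
          (Snowflake.F P (fun ω => Snowflake.snowflake φ k (fun n => θ n ω)) t β)}) := by
  obtain ⟨M, H⟩ := hφ.exists_isConformalFamily hk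
  have hΘ : AEMeasurable (fun ω n => θ n ω) P :=
    aemeasurable_pi_iff.2 fun n => (hunif n).aemeasurable
  have hmap := Snowflake.map_eq_angleLaw hindep hunif
  have hmeans : ∀ β R, Snowflake.meansIntegral P
      (fun ω => Snowflake.snowflake φ k (fun n => θ n ω)) t β R = ∞ ↔
      ¬ Snowflake.radialIntegral (Snowflake.snowflake φ k) t β R < ∞ := fun β R => by
    rw [H.meansIntegral_eq hΘ hmap, ← Snowflake.ofReal_two_pi_mul_lt_top_iff, not_lt, top_le_iff]
  have hclass : ∀ β, Snowflake.ClassL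
      (Snowflake.F P (fun ω => Snowflake.snowflake φ k (fun n => θ n ω)) t β) ↔
      ∀ R, 1 < R → Snowflake.radialIntegral (Snowflake.snowflake φ k) t β R < ∞ := by
    intro β
    have hF : Snowflake.F P (fun ω => Snowflake.snowflake φ k (fun n => θ n ω)) t β =
        Snowflake.inverseMean (Snowflake.snowflake φ k) t β :=
      funext fun r => H.F_eq hΘ hmap t β r
    rw [hF]
    constructor
    · intro h R hR
      exact H.radialIntegral_lt_top_of_inverseMean t β hR
        (h (R * M) (one_lt_mul_of_lt_of_le hR H.one_le)).2
    · exact fun h R hR => ⟨(H.measurable_inverseMean t β).aemeasurable,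
        H.inverseMean_lt_top_of_radialIntegral t β hR (h R hR)⟩
  refine Snowflake.sSup_coe_image_eq_sInf_coe_image (fun β => ?_) fun β hβ γ hγ => ?_
  -- Divergence for every R and convergence for every R are complementary, since convergence for one
  -- R gives it for all.
  · by_cases h : ∃ R₀, 1 < R₀ ∧ Snowflake.radialIntegral (Snowflake.snowflake φ k) t β R₀ < ∞
    · obtain ⟨R₀, hR₀, h⟩ := h
      exact Or.inr ((hclass β).2 fun R _ => H.radialIntegral_lt_top hR₀ h R)
    · push Not at h
      exact Or.inl fun R hR => (hmeans β R).2 (not_lt.2 (h R hR))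
  · by_contra hlt
    push Not at hlt
    exact (hmeans β 2).1 (hβ 2 one_lt_two) (H.radialIntegral_lt_top_of_le hlt.le one_lt_two
      ((hclass γ).1 hγ 2 one_lt_two))
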